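/- **Proposition 4.2.** Let $E=(E^0,E^1,r,s)$ be a row-finite directed graph (every vertex emits only finitely many edges; $E^0$ and $E^1$ are arbitrary sets), let $F$ be a field, and let $L_F(E)$ be the Leavitt path algebra of $E$ over $F$, with its canonical $\mathbb Z$-grading (vertices in degree $0$, edges in degree $1$, ghost edges in degree $-1$). Let $M^{\mathrm{gr}}_E$ be the abelian monoid generated by $\{v(i) \mid v\in E^0,\ i\in\mathbb Z\}$ subject to the relations $$v(i)=\sum_{e\in s^{-1}(v)} r(e)(i+1)$$ for all $i\in\mathbb Z$ and every $v\in E^0$ that is not a sink, with the $\mathbb Z$-action ${}^n v(i)=v(i+n)$. Then $L_F(E)$ has a two-sided ideal that is not graded if and only if there is a $\mathbb Z$-order-ideal $I$ of $M^{\mathrm{gr}}_E$ such that the quotient monoid $M^{\mathrm{gr}}_E/I$ has a periodic element. Here a $\mathbb Z$-order-ideal $I$ of $M=M^{\mathrm{gr}}_E$ is a submonoid that is closed under the action and such that $a+c\in I$ implies $a\in I$. The monoid $M/I$ is the quotient of $M$ by the congruence $a\sim b \iff a+i=b+j$ for some $i,j\in I$, with the induced action. A periodic element is an element $a\neq 0$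 with ${}^n a=a$ for some $n\neq 0$ in $\mathbb Z$. -/

import Mathlib

universe u w x

/-! ### Directed graphs -/

/-- A directed graph with vertex set `V`, edge set `A` (loops and parallel edges allowed),
with source and range maps. -/
structure DirGraph (V : Type u) (A : Type w) where
  src : A → V
  rng : A → V

namespace DirGraph

variable {V : Type u} {A : Type w} (E : DirGraph V A)

/-- The set of edges emitted by the vertex `v`. -/
def outEdges (v : V) : Set A := {e | E.src e = v}

/-- Every vertex emits finitely many edges. -/
def RowFinite : Prop := ∀ v, (E.outEdges v).Finite

end DirGraph

/-! ### Leavitt path algebras -/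

/-- The generators of a Leavitt path algebra: the vertices, the edges `e`
and the ghost edges `e*`. -/
inductive LeavittGen (V : Type u) (A : Type w) : Type (max u w)
  | vertex (v : V)
  | edge (e : A)
  | ghost (e : A)

/-- Vertices have degree `0`, edges degree `1`, ghost edges degree `-1`. -/
def LeavittGen.degree {V : Type u} {A : Type w} : LeavittGen V A → ℤ
  | .vertex _ => 0
  | .edge _ => 1
  | .ghost _ => -1

namespace DirGraph

open LeavittGen

variable {V : Type u} {A : Type w} (E : DirGraph V A) (F : Type x) [Field F]

/-- The defining relations of the Leavitt path algebra `L_F(E)`. -/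
inductive LeavittRel :
    FreeAlgebra F (LeavittGen V A) → FreeAlgebra F (LeavittGen V A) → Prop
  | vertex_idem (v : V) :
      LeavittRel (FreeAlgebra.ι F (vertex v) * FreeAlgebra.ι F (vertex v))
        (FreeAlgebra.ι F (vertex v))
  | vertex_orth (v v' : V) (h : v ≠ v') :
      LeavittRel (FreeAlgebra.ι F (vertex v) * FreeAlgebra.ι F (vertex v')) 0
  | src_edge (e : A) :
      LeavittRel (FreeAlgebra.ι F (vertex (E.src e)) * FreeAlgebra.ι F (edge e))
        (FreeAlgebra.ι F (edge e))
  | edge_rng (e : A) :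
      LeavittRel (FreeAlgebra.ι F (edge e) * FreeAlgebra.ι F (vertex (E.rng e)))
        (FreeAlgebra.ι F (edge e))
  | rng_ghost (e : A) :
      LeavittRel (FreeAlgebra.ι F (vertex (E.rng e)) * FreeAlgebra.ι F (ghost e))
        (FreeAlgebra.ι F (ghost e))
  | ghost_src (e : A) :
      LeavittRel (FreeAlgebra.ι F (ghost e) * FreeAlgebra.ι F (vertex (E.src e)))
        (FreeAlgebra.ι F (ghost e))
  | ck1_same (e : A) :
      LeavittRel (FreeAlgebra.ι F (ghost e) * FreeAlgebra.ι F (edge e))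
        (FreeAlgebra.ι F (vertex (E.rng e)))
  | ck1_ne (e f : A) (h : e ≠ f) :
      LeavittRel (FreeAlgebra.ι F (ghost e) * FreeAlgebra.ι F (edge f)) 0
  | ck2 (v : V) (hfin : (E.outEdges v).Finite) (hne : (E.outEdges v).Nonempty) :
      LeavittRel (FreeAlgebra.ι F (vertex v))
        (∑ e ∈ hfin.toFinset, FreeAlgebra.ι F (edge e) * FreeAlgebra.ι F (ghost e))

/-- The *unital* `F`-algebra presented by the generators and relations of `L_F(E)`.
Since no relation has a constant term, this is the unitization `F ⊕ L_F(E)` of the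
(in general non-unital) algebra `L_F(E)` with the same presentation. -/
abbrev LeavittUnitization : Type (max u w x) := RingQuot (E.LeavittRel F)

/-- The image of a generator in the unitization. -/
def leavittGenUnitization (g : LeavittGen V A) : E.LeavittUnitization F :=
  RingQuot.mkAlgHom F (E.LeavittRel F) (FreeAlgebra.ι F g)

/-- The Leavitt path algebra `L_F(E)`, the (in general non-unital) `F`-algebra presented by the
generators and relations above: it consists of the linear combinations of nonempty products of
generators inside its unitization. -/
abbrev LeavittPathAlgebra : Type (max u w x) :=
  ↥(NonUnitalAlgebra.adjoin F (Set.range (E.leavittGenUnitization F)))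

/-- The generators of `L_F(E)`. -/
def leavittGen (g : LeavittGen V A) : E.LeavittPathAlgebra F :=
  ⟨E.leavittGenUnitization F g, NonUnitalAlgebra.subset_adjoin F ⟨g, rfl⟩⟩

/-- `E.LeavittMonomial F n y`: the element `y` of `L_F(E)` is a nonempty product of generators
whose degrees add up to `n`. -/
inductive LeavittMonomial : ℤ → E.LeavittPathAlgebra F → Prop
  | gen (g : LeavittGen V A) : LeavittMonomial g.degree (E.leavittGen F g)
  | mul {m n : ℤ} {y z : E.LeavittPathAlgebra F} (hy : LeavittMonomial m y)
      (hz : LeavittMonomial n z) : LeavittMonomial (m + n) (y * z)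

/-- The homogeneous component of degree `n` of the `ℤ`-graded algebra `L_F(E)`. -/
def leavittComponent (n : ℤ) : Submodule F (E.LeavittPathAlgebra F) :=
  Submodule.span F {y | E.LeavittMonomial F n y}

/-- A two-sided ideal `J` of `L_F(E)` is graded if each of its elements is a finite sum of
homogeneous elements of `J`, i.e. `J = ⨁ₙ (J ∩ L_F(E)ₙ)`. -/
def IsGradedIdeal (J : TwoSidedIdeal (E.LeavittPathAlgebra F)) : Prop :=
  ∀ y ∈ J, y ∈ AddSubmonoid.closure {z | z ∈ J ∧ ∃ n : ℤ, z ∈ E.leavittComponent F n}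

end DirGraph

/-! ### Abelian monoids with a group action -/

/-- A `Γ`-order-ideal of a `Γ`-monoid `M`: a submonoid closed under the action and hereditary for
the preorder `a ≤ b ↔ ∃ c, b = a + c`. -/
structure OrderIdeal (Γ : Type w) (M : Type u) [Group Γ] [AddCommMonoid M]
    [DistribMulAction Γ M] extends AddSubmonoid M where
  smul_mem' : ∀ (γ : Γ) {a : M}, a ∈ carrier → γ • a ∈ carrier
  hereditary' : ∀ {a b : M}, (∃ c, b = a + c) → b ∈ carrier → a ∈ carrier

namespace OrderIdeal

variable {Γ : Type w} {M : Type u} [Group Γ] [AddCommMonoid M] [DistribMulAction Γ M]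
  (I : OrderIdeal Γ M)

/-- The congruence `a ∼ b ↔ ∃ i j ∈ I, a + i = b + j`. -/
def con : AddCon M where
  r a b := ∃ i ∈ I.toAddSubmonoid, ∃ j ∈ I.toAddSubmonoid, a + i = b + j
  iseqv := by
    refine ⟨fun a => ⟨0, zero_mem _, 0, zero_mem _, rfl⟩, ?_, ?_⟩
    · rintro a b ⟨i, hi, j, hj, h⟩
      exact ⟨j, hj, i, hi, h.symm⟩
    · rintro a b c ⟨i, hi, j, hj, h⟩ ⟨k, hk, l, hl, h'⟩
      refine ⟨i + k, add_mem hi hk, l + j, add_mem hl hj, ?_⟩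
      rw [← add_assoc, h, add_right_comm, h', add_assoc]
  add' := by
    rintro a b c d ⟨i, hi, j, hj, h⟩ ⟨k, hk, l, hl, h'⟩
    refine ⟨i + k, add_mem hi hk, j + l, add_mem hj hl, ?_⟩
    rw [add_add_add_comm, h, h', add_add_add_comm]

/-- The quotient monoid `M / I`. -/
abbrev Quotient : Type u := I.con.Quotient

/-- The action of `γ` on `M / I`, induced by the action on `M`. -/
def quotientSMulHom (γ : Γ) : I.Quotient →+ I.Quotient :=
  I.con.lift (I.con.mk'.comp (DistribSMul.toAddMonoidHom M γ)) (by
    rintro a b ⟨i, hi, j, hj, h⟩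
    refine (AddCon.eq I.con).2 ⟨γ • i, I.smul_mem' γ hi, γ • j, I.smul_mem' γ hj, ?_⟩
    simp only [DistribSMul.toAddMonoidHom_apply, ← smul_add, h])

instance : DistribMulAction Γ I.Quotient where
  smul γ a := I.quotientSMulHom γ a
  one_smul a := by
    induction a using AddCon.induction_on with
    | _ a => exact congrArg (I.con.mk') (one_smul Γ a)
  mul_smul γ δ a := by
    induction a using AddCon.induction_on with
    | _ a => exact congrArg (I.con.mk') (mul_smul γ δ a)
  smul_zero γ := map_zero (I.quotientSMulHom γ)
  smul_add γ a b := map_add (I.quotientSMulHom γ) a b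

end OrderIdeal

/-- A periodic element of a `Γ`-monoid: a nonzero element fixed by some `γ ≠ 1`. -/
def IsPeriodicElement (Γ : Type w) {M : Type u} [Group Γ] [AddCommMonoid M]
    [DistribMulAction Γ M] (a : M) : Prop :=
  a ≠ 0 ∧ ∃ γ : Γ, γ ≠ 1 ∧ γ • a = a

/-! ### The graded graph monoid -/

namespace DirGraph

variable {V : Type u} {A : Type w} (E : DirGraph V A)

/-- The defining relations `v(i) = ∑_{e ∈ s⁻¹(v)} r(e)(i+1)`, for `v` not a sink, on the free
abelian monoid on the symbols `v(i)`; here `v(i)` is `Finsupp.single (v, i) 1`. (A vertex emitting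
infinitely many edges, which does not occur in a row-finite graph, gets no relation.) -/
inductive TalentedRel : ((V × ℤ) →₀ ℕ) → ((V × ℤ) →₀ ℕ) → Prop
  | expand (v : V) (i : ℤ) (hfin : (E.outEdges v).Finite) (hne : (E.outEdges v).Nonempty) :
      TalentedRel (Finsupp.single (v, i) 1)
        (∑ e ∈ hfin.toFinset, Finsupp.single (E.rng e, i + 1) 1)

/-- The graded graph monoid `M^gr_E`. -/
abbrev TalentedMonoid : Type u := (addConGen E.TalentedRel).Quotient

/-- The shift `v(k) ↦ v(k + n)` on the free abelian monoid. -/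
noncomputable def freeShift (V : Type u) (n : ℤ) : ((V × ℤ) →₀ ℕ) →+ ((V × ℤ) →₀ ℕ) :=
  Finsupp.mapDomain.addMonoidHom fun p => (p.1, p.2 + n)

theorem freeShift_single (n : ℤ) (v : V) (k : ℤ) (m : ℕ) :
    freeShift V n (Finsupp.single (v, k) m) = Finsupp.single (v, k + n) m := by
  simp [freeShift]

/-- The shift `v(k) ↦ v(k + n)` on `M^gr_E`. -/
noncomputable def shift (n : ℤ) : E.TalentedMonoid →+ E.TalentedMonoid :=
  (addConGen E.TalentedRel).lift ((addConGen E.TalentedRel).mk'.comp (freeShift V n)) (by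
    refine AddCon.addConGen_le.2 ?_
    rintro _ _ ⟨v, i, hfin, hne⟩
    refine (AddCon.eq _).2 ?_
    rw [freeShift_single, map_sum]
    simp only [freeShift_single, add_right_comm i 1 n]
    exact AddConGen.Rel.of _ _ (TalentedRel.expand v (i + n) hfin hne))

/-- The `ℤ`-action `ⁿv(k) = v(k + n)` on `M^gr_E`; the group `ℤ` is written multiplicatively. -/
noncomputable instance : DistribMulAction (Multiplicative ℤ) E.TalentedMonoid where
  smul n a := E.shift n.toAdd a
  one_smul a := by
    induction a using AddCon.induction_on with
    | _ a =>
      refine congrArg ((addConGen E.TalentedRel).mk') ?_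
      change freeShift V 0 a = a
      simp only [freeShift, Finsupp.mapDomain.addMonoidHom, add_zero]
      exact Finsupp.mapDomain_id
  mul_smul m n a := by
    induction a using AddCon.induction_on with
    | _ a =>
      refine congrArg ((addConGen E.TalentedRel).mk') ?_
      change freeShift V (m.toAdd + n.toAdd) a = freeShift V m.toAdd (freeShift V n.toAdd a)
      induction a using Finsupp.induction_linear with
      | zero => simp
      | add f g hf hg => simp only [map_add, hf, hg]
      | single p k =>
        obtain ⟨v, i⟩ := p
        simp only [freeShift_single]
        congr 2
        ring
  smul_zero n := map_zero (E.shift n.toAdd)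
  smul_add n a b := map_add (E.shift n.toAdd) a b

end DirGraph

/-! Both sides are equivalent to a condition on the graph: for some hereditary saturated set `H`,
the graph outside `H` has a cycle with no exits, that is, every other edge leaving the cycle ends in
`H`.

From a cycle to a periodic element (`exists_isPeriodicElement`): modulo the order-ideal of `H`, the
relation at a vertex of the cycle retains a single summand, so one turn around the cycle gives `v(0)
= v(m)`, where `v` is nonzero because it lies outside `H`.

From a periodic element to a cycle (`hasRelativelyExitlessCycle_of_isPeriodicElement`): equality in
the quotient becomes equality of the expansions to all high levels, with the vertices of the ideal
deleted. A periodic class thus yields a nonzero `y` whose `n`-fold expansion is its shift by `n`.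
Expansion never lowers the number of terms and shifting preserves it, so no term branches; sinks
cannot occur since they never move. The finitely many vertices involved each emit exactly one edge
outside `H`, and following these edges closes up.

From a cycle to a nongraded ideal (`exists_not_isGradedIdeal`): the algebra acts on functions on
infinite paths off `H`, and also on functions with an additional integer coordinate that records the
degree. The kernel of the first action contains `v - e₀⋯eₘ₋₁`, since the cycle is the only path from
`v`. Homogeneous elements of this kernel vanish in the second action, but `v - e₀⋯eₘ₋₁` does not.

From a nongraded ideal to a cycle (`hasRelativelyExitlessCycle_of_not_isGradedIdeal`): the ideal `J`
contains some `c v` plus a combination of paths of positive length, with `c ≠ 0` and `v ∉ J`. Among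
these take one with fewest terms. Passing from `z` to `e* z e`, for an edge `e` from `v` ending
outside `J`, rotates the paths that begin with `e` and kills the others. Minimality forces every
path to begin with `e`, so `e` is unique, and successive rotations of one path trace the cycle. -/

namespace DirGraph

/-! ### Relatively exitless cycles give periodic elements -/

variable {V : Type u} {A : Type w} (E : DirGraph V A)

/-- A set of vertices is hereditary if it is closed under following edges, and saturated if it
contains every non-sink all of whose edges end in it. -/
structure HereditarySaturated (H : Set V) : Prop where
  rng_mem : ∀ e, E.src e ∈ H → E.rng e ∈ H
  src_mem : ∀ v, (E.outEdges v).Nonempty → (∀ e, E.src e = v → E.rng e ∈ H) → v ∈ H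

/-- The sequence of edges `e` runs through a cycle of length `m` outside `H`, all of whose exits
lead into `H`. -/
structure IsExitlessCycle (H : Set V) (e : ℕ → A) (m : ℕ) : Prop where
  pos : 0 < m
  rng_eq : ∀ i, E.rng (e i) = E.src (e (i + 1))
  src_notMem : ∀ i, E.src (e i) ∉ H
  eq_of_src_eq : ∀ i f, E.src f = E.src (e i) → E.rng f ∉ H → f = e i
  src_closed : E.src (e m) = E.src (e 0)

/-- Some quotient of the graph by a hereditary saturated set has a cycle without exits. -/
def HasRelativelyExitlessCycle : Prop :=
  ∃ H : Set V, E.HereditarySaturated H ∧ ∃ e m, E.IsExitlessCycle H e m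

variable {E}

/-- The congruence on the free monoid identifying elements supported in `H`, and identifying
elements not supported in `H`. -/
def supportCon (H : Set V) : AddCon ((V × ℤ) →₀ ℕ) where
  r x y := (∀ p, x p ≠ 0 → p.1 ∈ H) ↔ (∀ p, y p ≠ 0 → p.1 ∈ H)
  iseqv := ⟨fun _ => Iff.rfl, fun h => h.symm, fun h h' => h.trans h'⟩
  add' := by
    intro a b c d h h'
    have key : ∀ x y : (V × ℤ) →₀ ℕ, (∀ p, (x + y) p ≠ 0 → p.1 ∈ H) ↔
        (∀ p, x p ≠ 0 → p.1 ∈ H) ∧ (∀ p, y p ≠ 0 → p.1 ∈ H) := by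
      intro x y
      rw [← forall_and]
      refine forall_congr' fun p => ?_
      rw [Finsupp.add_apply, Ne, Nat.add_eq_zero_iff]
      tauto
    change (∀ p, (a + c) p ≠ 0 → p.1 ∈ H) ↔ (∀ p, (b + d) p ≠ 0 → p.1 ∈ H)
    rw [key, key]
    exact and_congr h h'

theorem supportCon_iff {H : Set V} {x y : (V × ℤ) →₀ ℕ} :
    supportCon H x y ↔ ((∀ p, x p ≠ 0 → p.1 ∈ H) ↔ (∀ p, y p ≠ 0 → p.1 ∈ H)) := Iff.rfl

theorem single_support_iff {H : Set V} {v : V} {i : ℤ} :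
    (∀ p, (Finsupp.single (v, i) 1 : (V × ℤ) →₀ ℕ) p ≠ 0 → p.1 ∈ H) ↔ v ∈ H := by
  constructor
  · intro h
    exact h (v, i) (by simp)
  · intro h p hp
    classical
    rw [Finsupp.single_apply] at hp
    split_ifs at hp with h'
    · exact h' ▸ h
    · exact absurd rfl hp

/-- Heredity passes support in `H` from `v(i)` to its expansion, and saturation passes it back.
Hence being supported in `H` is a property of classes in the graded graph monoid. -/
theorem HereditarySaturated.addConGen_le {H : Set V} (hH : E.HereditarySaturated H) :
    addConGen E.TalentedRel ≤ supportCon H := by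
  refine AddCon.addConGen_le.2 ?_
  rintro _ _ ⟨v, i, hfin, hne⟩
  rw [supportCon_iff, single_support_iff]
  constructor
  · intro hv p hp
    rw [Finsupp.finsetSum_apply] at hp
    obtain ⟨e, he, hep⟩ := Finset.exists_ne_zero_of_sum_ne_zero hp
    have hs : E.src e = v := by simpa [outEdges] using he
    exact single_support_iff.2 (hH.rng_mem e (hs ▸ hv)) p hep
  · intro h
    refine hH.src_mem v hne fun e he => h (E.rng e, i + 1) ?_
    rw [Finsupp.finsetSum_apply]
    refine fun h0 => ?_
    have := Finset.sum_eq_zero_iff.1 h0 e (by simpa [outEdges] using he)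
    simp at this

theorem smul_mk (n : Multiplicative ℤ) (x : (V × ℤ) →₀ ℕ) :
    n • (addConGen E.TalentedRel).mk' x = (addConGen E.TalentedRel).mk' (freeShift V n.toAdd x) :=
  rfl

/-- The order-ideal of the graded graph monoid generated by a hereditary saturated set. -/
def HereditarySaturated.orderIdeal {H : Set V} (hH : E.HereditarySaturated H) :
    OrderIdeal (Multiplicative ℤ) E.TalentedMonoid where
  -- All representatives are required to be supported in `H`; by `addConGen_le`, a single one
  -- decides.
  carrier := {a | ∀ x, (addConGen E.TalentedRel).mk' x = a → ∀ p, x p ≠ 0 → p.1 ∈ H}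
  zero_mem' := by
    intro x hx
    have := hH.addConGen_le ((AddCon.eq _).1 (hx : (x : E.TalentedMonoid) = (0 : (V × ℤ) →₀ ℕ)))
    exact (supportCon_iff.1 this).2 (by simp)
  add_mem' := by
    intro a b ha hb
    induction a using AddCon.induction_on with | _ a
    induction b using AddCon.induction_on with | _ b
    intro x hx
    have := hH.addConGen_le ((AddCon.eq _).1 (hx : (x : E.TalentedMonoid) = (a + b : (V × ℤ) →₀ ℕ)))
    refine (supportCon_iff.1 this).2 fun p hp => ?_
    rw [Finsupp.add_apply, Ne, Nat.add_eq_zero_iff, not_and_or] at hp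
    exact hp.elim (ha a rfl p) (hb b rfl p)
  smul_mem' := by
    intro n a ha
    induction a using AddCon.induction_on with | _ a
    intro x hx
    have := hH.addConGen_le ((AddCon.eq _).1
      (hx : (x : E.TalentedMonoid) = (freeShift V n.toAdd a : (V × ℤ) →₀ ℕ)))
    refine (supportCon_iff.1 this).2 fun p hp => ?_
    have hp' : p ∈ (Finsupp.mapDomain (fun p : V × ℤ => (p.1, p.2 + n.toAdd)) a).support :=
      Finsupp.mem_support_iff.2 hp
    classical
    obtain ⟨q, hq, rfl⟩ := Finset.mem_image.1 (Finsupp.mapDomain_support hp')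
    exact ha a rfl q (Finsupp.mem_support_iff.1 hq)
  hereditary' := by
    rintro a _ ⟨c, rfl⟩ h x rfl p hp
    induction c using AddCon.induction_on with | _ c
    refine h (x + c) rfl p ?_
    rw [Finsupp.add_apply]
    omega

theorem HereditarySaturated.mem_orderIdeal {H : Set V} (hH : E.HereditarySaturated H) {v : V}
    {i : ℤ} :
    (addConGen E.TalentedRel).mk' (Finsupp.single (v, i) 1) ∈ hH.orderIdeal.toAddSubmonoid ↔
      v ∈ H := by
  constructor
  · intro h
    exact single_support_iff.1 (h _ rfl)
  · intro h x hx
    have := hH.addConGen_le ((AddCon.eq _).1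
      (hx : (x : E.TalentedMonoid) = (Finsupp.single (v, i) 1 : (V × ℤ) →₀ ℕ)))
    exact (supportCon_iff.1 this).2 (single_support_iff.2 h)

theorem orderIdeal_mk_eq_zero {Γ : Type w} {M : Type u} [Group Γ] [AddCommMonoid M]
    [DistribMulAction Γ M] (I : OrderIdeal Γ M) {a : M} :
    I.con.mk' a = 0 ↔ a ∈ I.toAddSubmonoid := by
  constructor
  · intro h
    obtain ⟨i, hi, j, hj, hij⟩ := (AddCon.eq I.con).1 (h : (a : I.Quotient) = (0 : M))
    rw [zero_add] at hij
    exact I.hereditary' ⟨i, rfl⟩ (hij ▸ hj)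
  · intro h
    exact (AddCon.eq I.con).2 ⟨0, zero_mem _, a, h, by rw [zero_add, add_zero]⟩

theorem mk_single_eq_sum (v : V) (i : ℤ) (hfin : (E.outEdges v).Finite)
    (hne : (E.outEdges v).Nonempty) :
    (addConGen E.TalentedRel).mk' (Finsupp.single (v, i) 1) =
      ∑ e ∈ hfin.toFinset, (addConGen E.TalentedRel).mk' (Finsupp.single (E.rng e, i + 1) 1) := by
  rw [← map_sum]
  exact (AddCon.eq _).2 (AddConGen.Rel.of _ _ (TalentedRel.expand v i hfin hne))

theorem exists_isPeriodicElement (hE : E.RowFinite) (h : E.HasRelativelyExitlessCycle) :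
    ∃ (I : OrderIdeal (Multiplicative ℤ) E.TalentedMonoid) (a : I.Quotient),
      IsPeriodicElement (Multiplicative ℤ) a := by
  obtain ⟨H, hH, e, m, hc⟩ := h
  let I := hH.orderIdeal
  let π : ((V × ℤ) →₀ ℕ) →+ I.Quotient := I.con.mk'.comp (addConGen E.TalentedRel).mk'
  have hπ : ∀ v i, π (Finsupp.single (v, i) 1) = 0 ↔ v ∈ H := fun v i =>
    (orderIdeal_mk_eq_zero I).trans hH.mem_orderIdeal
  -- Every summand other than the one for `e k` comes from an exit into `H` and vanishes under `π`.
  have hstep : ∀ k i, π (Finsupp.single (E.src (e k), i) 1) =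
      π (Finsupp.single (E.src (e (k + 1)), i + 1) 1) := by
    intro k i
    have h1 := congrArg I.con.mk' (mk_single_eq_sum (E.src (e k)) i (hE _) ⟨e k, rfl⟩)
    rw [map_sum] at h1
    refine h1.trans ?_
    rw [Finset.sum_eq_single (e k)]
    · rw [hc.rng_eq]; rfl
    · intro f hf hne
      refine (hπ (E.rng f) (i + 1)).2 (by_contra fun hr => hne ?_)
      exact hc.eq_of_src_eq k f (by simpa [outEdges] using hf) hr
    · intro h
      exact absurd (by simp [outEdges]) h
  have hiter : ∀ k : ℕ, π (Finsupp.single (E.src (e 0), 0) 1) =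
      π (Finsupp.single (E.src (e k), (k : ℤ)) 1) := by
    intro k
    induction k with
    | zero => simp
    | succ k ih => rw [ih, hstep]; push_cast; rfl
  refine ⟨I, π (Finsupp.single (E.src (e 0), 0) 1), ?_, Multiplicative.ofAdd (m : ℤ), ?_, ?_⟩
  · rw [Ne, hπ]
    exact hc.src_notMem 0
  · intro h
    have : (m : ℤ) = 0 := Multiplicative.ofAdd.injective h
    have := hc.pos
    omega
  · have h1 : Multiplicative.ofAdd (m : ℤ) • π (Finsupp.single (E.src (e 0), 0) 1) =
        π (freeShift V m (Finsupp.single (E.src (e 0), 0) 1)) := rfl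
    rw [h1, freeShift_single, zero_add]
    conv_rhs => rw [hiter m, hc.src_closed]

end DirGraph

/-! ### Expansions in the free monoid -/

namespace DirGraph

variable {V : Type u} {A : Type w} {E : DirGraph V A}

open Filter

/-- Additive maps out of the free commutative monoid on `α` are determined by the basis. -/
theorem finsupp_nat_addHom_ext {α M : Type*} [AddCommMonoid M] {f g : (α →₀ ℕ) →+ M}
    (h : ∀ p, f (Finsupp.single p 1) = g (Finsupp.single p 1)) : f = g :=
  Finsupp.addHom_ext' fun p => AddMonoidHom.ext_nat (h p)

/-- The additive extension of a map defined on the basis of a free commutative monoid. -/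
noncomputable def basisExtend {α M : Type*} [AddCommMonoid M] (f : α → M) : (α →₀ ℕ) →+ M :=
  Finsupp.liftAddHom fun p => multiplesHom M (f p)

theorem basisExtend_single {α M : Type*} [AddCommMonoid M] (f : α → M) (p : α) :
    basisExtend f (Finsupp.single p 1) = f p := by
  simp [basisExtend]

theorem basisExtend_apply {α M : Type*} [AddCommMonoid M] (f : α → M) (x : α →₀ ℕ) :
    basisExtend f x = ∑ p ∈ x.support, x p • f p := by
  simp [basisExtend, Finsupp.sum]

open Classical in
/-- Kill the basis elements lying over `H`. -/
noncomputable def kill (H : Set V) : ((V × ℤ) →₀ ℕ) →+ ((V × ℤ) →₀ ℕ) :=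
  basisExtend fun p => if p.1 ∈ H then 0 else Finsupp.single p 1

open Classical in
/-- Kill the basis elements lying over `H`, and expand the others once if they are not sinks. -/
noncomputable def expandOnce (hE : E.RowFinite) (H : Set V) :
    ((V × ℤ) →₀ ℕ) →+ ((V × ℤ) →₀ ℕ) :=
  basisExtend fun p => if p.1 ∈ H then 0 else
    if (E.outEdges p.1).Nonempty then
      ∑ e ∈ (hE p.1).toFinset, kill H (Finsupp.single (E.rng e, p.2 + 1) 1)
    else Finsupp.single p 1

theorem kill_of_mem {H : Set V} {v : V} (hv : v ∈ H) (i : ℤ) :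
    kill H (Finsupp.single (v, i) 1) = 0 := by
  rw [kill, basisExtend_single, if_pos hv]

theorem kill_of_notMem {H : Set V} {v : V} (hv : v ∉ H) (i : ℤ) :
    kill H (Finsupp.single (v, i) 1) = Finsupp.single (v, i) 1 := by
  rw [kill, basisExtend_single, if_neg hv]

variable (hE : E.RowFinite)

theorem expandOnce_of_mem {H : Set V} {v : V} (hv : v ∈ H) (i : ℤ) :
    expandOnce hE H (Finsupp.single (v, i) 1) = 0 := by
  rw [expandOnce, basisExtend_single, if_pos hv]

theorem expandOnce_of_nonempty {H : Set V} {v : V} (hv : v ∉ H) (hne : (E.outEdges v).Nonempty)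
    (i : ℤ) : expandOnce hE H (Finsupp.single (v, i) 1) =
      ∑ e ∈ (hE v).toFinset, kill H (Finsupp.single (E.rng e, i + 1) 1) := by
  rw [expandOnce, basisExtend_single, if_neg hv, if_pos hne]

theorem expandOnce_of_sink {H : Set V} {v : V} (hv : v ∉ H) (hne : ¬ (E.outEdges v).Nonempty)
    (i : ℤ) : expandOnce hE H (Finsupp.single (v, i) 1) = Finsupp.single (v, i) 1 := by
  rw [expandOnce, basisExtend_single, if_neg hv, if_neg hne]

theorem kill_freeShift (H : Set V) (n : ℤ) (x : (V × ℤ) →₀ ℕ) :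
    kill H (freeShift V n x) = freeShift V n (kill H x) := by
  refine DFunLike.congr_fun (f := (kill H).comp (freeShift V n))
    (g := (freeShift V n).comp (kill H)) (finsupp_nat_addHom_ext ?_) x
  rintro ⟨v, i⟩
  by_cases hv : v ∈ H
  · simp [kill_of_mem hv, freeShift_single]
  · simp [kill_of_notMem hv, freeShift_single]

theorem expandOnce_freeShift (H : Set V) (n : ℤ) (x : (V × ℤ) →₀ ℕ) :
    expandOnce hE H (freeShift V n x) = freeShift V n (expandOnce hE H x) := by
  refine DFunLike.congr_fun (f := (expandOnce hE H).comp (freeShift V n))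
    (g := (freeShift V n).comp (expandOnce hE H)) (finsupp_nat_addHom_ext ?_) x
  rintro ⟨v, i⟩
  simp only [AddMonoidHom.comp_apply, freeShift_single]
  by_cases hv : v ∈ H
  · simp [expandOnce_of_mem hE hv]
  · by_cases hne : (E.outEdges v).Nonempty
    · rw [expandOnce_of_nonempty hE hv hne, expandOnce_of_nonempty hE hv hne, map_sum]
      refine Finset.sum_congr rfl fun e _ => ?_
      rw [← kill_freeShift, freeShift_single]
      congr 3
      ring
    · rw [expandOnce_of_sink hE hv hne, expandOnce_of_sink hE hv hne, freeShift_single]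

theorem iterate_expandOnce_freeShift (H : Set V) (n : ℤ) (k : ℕ) (x : (V × ℤ) →₀ ℕ) :
    (expandOnce hE H)^[k] (freeShift V n x) = freeShift V n ((expandOnce hE H)^[k] x) := by
  induction k with
  | zero => rfl
  | succ k ih => rw [Function.iterate_succ_apply', ih, Function.iterate_succ_apply',
      expandOnce_freeShift]

/-- Kill `H` and expand every `v(i)` up to level `k`. -/
noncomputable def expandTo (H : Set V) (k : ℤ) : ((V × ℤ) →₀ ℕ) →+ ((V × ℤ) →₀ ℕ) :=
  basisExtend fun p => (expandOnce hE H)^[(k - p.2).toNat] (kill H (Finsupp.single p 1))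

theorem expandTo_single (H : Set V) (k : ℤ) (v : V) (i : ℤ) :
    expandTo hE H k (Finsupp.single (v, i) 1) =
      (expandOnce hE H)^[(k - i).toNat] (kill H (Finsupp.single (v, i) 1)) := by
  rw [expandTo, basisExtend_single]

theorem expandTo_single_of_mem {H : Set V} (k : ℤ) {v : V} (hv : v ∈ H) (i : ℤ) :
    expandTo hE H k (Finsupp.single (v, i) 1) = 0 := by
  rw [expandTo_single, kill_of_mem hv, iterate_map_zero]

theorem expandTo_freeShift (H : Set V) (k n : ℤ) (x : (V × ℤ) →₀ ℕ) :
    expandTo hE H (k + n) (freeShift V n x) = freeShift V n (expandTo hE H k x) := by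
  refine DFunLike.congr_fun (f := (expandTo hE H (k + n)).comp (freeShift V n))
    (g := (freeShift V n).comp (expandTo hE H k)) (finsupp_nat_addHom_ext ?_) x
  rintro ⟨v, i⟩
  simp only [AddMonoidHom.comp_apply]
  rw [expandTo_single, freeShift_single, expandTo_single, ← freeShift_single, kill_freeShift,
    iterate_expandOnce_freeShift]
  congr 3
  ring

/-- A term `v(i)` needs `k ≥ i`: below that level `toNat` truncates to `0` and raising `k` expands
nothing. Only finitely many terms occur, so all large `k` work. -/
theorem eventually_expandTo_succ (H : Set V) (x : (V × ℤ) →₀ ℕ) :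
    ∀ᶠ k in atTop, expandTo hE H (k + 1) x = expandOnce hE H (expandTo hE H k x) := by
  induction x using Finsupp.induction_linear with
  | zero => simp
  | add x y hx hy =>
    filter_upwards [hx, hy] with k h1 h2
    simp only [map_add, h1, h2]
  | single p m =>
    obtain ⟨v, i⟩ := p
    filter_upwards [eventually_ge_atTop i] with k hk
    have : Finsupp.single (v, i) m = m • Finsupp.single (v, i) 1 := by simp
    rw [this, map_nsmul, map_nsmul, map_nsmul, expandTo_single, expandTo_single,
      ← Function.iterate_succ_apply' (expandOnce hE H)]
    congr 3
    omega

theorem iterate_addHom_sum {α M : Type*} [AddCommMonoid M] (f : M →+ M) (n : ℕ) (s : Finset α)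
    (g : α → M) : f^[n] (∑ a ∈ s, g a) = ∑ a ∈ s, f^[n] (g a) := by
  induction n with
  | zero => rfl
  | succ n ih => simp only [Function.iterate_succ_apply', ih, map_sum]

/-- Elements whose expansions eventually agree. -/
def expandCon (H : Set V) : AddCon ((V × ℤ) →₀ ℕ) where
  r x y := ∀ᶠ k in atTop, expandTo hE H k x = expandTo hE H k y
  iseqv := by
    refine ⟨fun _ => Eventually.of_forall fun _ => rfl, fun h => ?_, fun h h' => ?_⟩
    · filter_upwards [h] with k hk using hk.symm
    · filter_upwards [h, h'] with k hk hk' using hk.trans hk'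
  add' := by
    intro a b c d h h'
    filter_upwards [h, h'] with k hk hk'
    rw [map_add, map_add, hk, hk']

/-- For `k > i`, the first expansion of `v(i)` produces the right-hand side of the relation with `H`
deleted, and the remaining ones are those applied to `r(e)(i+1)`. This makes high expansions an
invariant of classes. -/
theorem HereditarySaturated.addConGen_le_expandCon {H : Set V} (hH : E.HereditarySaturated H) :
    addConGen E.TalentedRel ≤ expandCon hE H := by
  refine AddCon.addConGen_le.2 ?_
  rintro _ _ ⟨v, i, hfin, hne⟩
  change ∀ᶠ k in atTop, expandTo hE H k _ = expandTo hE H k _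
  filter_upwards [eventually_gt_atTop i] with k hk
  rw [map_sum]
  by_cases hv : v ∈ H
  · rw [expandTo_single_of_mem hE k hv, Finset.sum_eq_zero]
    intro e he
    have hs : E.src e = v := by simpa [outEdges] using he
    exact expandTo_single_of_mem hE k (hH.rng_mem e (hs ▸ hv)) _
  · have h1 : (k - i).toNat = (k - (i + 1)).toNat + 1 := by omega
    rw [expandTo_single, h1, Function.iterate_succ_apply, kill_of_notMem hv,
      expandOnce_of_nonempty hE hv hne, iterate_addHom_sum]
    exact Finset.sum_congr rfl fun e _ => (expandTo_single hE H k _ _).symm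

/-! ### Quotients by order-ideals -/

/-- The hereditary saturated set of vertices in an order-ideal. -/
def vertexSet (I : OrderIdeal (Multiplicative ℤ) E.TalentedMonoid) : Set V :=
  {v | (addConGen E.TalentedRel).mk' (Finsupp.single (v, 0) 1) ∈ I.toAddSubmonoid}

section vertexSet

variable (I : OrderIdeal (Multiplicative ℤ) E.TalentedMonoid)

theorem mk_single_mem_iff (v : V) (i : ℤ) :
    (addConGen E.TalentedRel).mk' (Finsupp.single (v, i) 1) ∈ I.toAddSubmonoid ↔
      v ∈ vertexSet I := by
  constructor
  · intro h
    have := I.smul_mem' (Multiplicative.ofAdd (-i)) h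
    rw [smul_mk, freeShift_single] at this
    simpa [vertexSet] using! this
  · intro h
    have := I.smul_mem' (Multiplicative.ofAdd i) h
    rw [smul_mk, freeShift_single] at this
    simpa using! this

theorem mk_mem_of_add {a b : E.TalentedMonoid} (h : a + b ∈ I.toAddSubmonoid) :
    a ∈ I.toAddSubmonoid := I.hereditary' ⟨b, rfl⟩ h

include hE in
theorem hereditarySaturated_vertexSet : E.HereditarySaturated (vertexSet I) where
  rng_mem := by
    intro e he
    have h1 := (mk_single_mem_iff I (E.src e) 0).2 he
    rw [mk_single_eq_sum _ _ (hE _) ⟨e, rfl⟩] at h1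
    rw [← mk_single_mem_iff I (E.rng e) (0 + 1)]
    classical
    rw [← Finset.add_sum_erase _ _ (a := e) (by simp [outEdges])] at h1
    exact mk_mem_of_add I h1
  src_mem := by
    intro v hne h
    rw [← mk_single_mem_iff I v 0, mk_single_eq_sum _ _ (hE _) hne]
    refine sum_mem fun e he => (mk_single_mem_iff I _ _).2 (h e (by simpa [outEdges] using he))

theorem mem_vertexSet_of_mk_mem {x : (V × ℤ) →₀ ℕ}
    (hx : (addConGen E.TalentedRel).mk' x ∈ I.toAddSubmonoid) {p : V × ℤ} (hp : x p ≠ 0) :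
    p.1 ∈ vertexSet I := by
  rw [← mk_single_mem_iff I p.1 p.2]
  have : x = Finsupp.single p 1 + (x - Finsupp.single p 1) := by
    refine (add_tsub_cancel_of_le (Finsupp.single_le_iff.2 (Nat.one_le_iff_ne_zero.2 hp))).symm
  rw [this, map_add] at hx
  exact mk_mem_of_add I hx

theorem expandTo_eq_zero_of_mk_mem {x : (V × ℤ) →₀ ℕ}
    (hx : (addConGen E.TalentedRel).mk' x ∈ I.toAddSubmonoid) (k : ℤ) :
    expandTo hE (vertexSet I) k x = 0 := by
  rw [expandTo, basisExtend_apply]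
  refine Finset.sum_eq_zero fun p hp => ?_
  have h := mem_vertexSet_of_mk_mem I hx (Finsupp.mem_support_iff.1 hp)
  rw [kill_of_mem h, iterate_map_zero, smul_zero]

/-- The projection of the free monoid onto the quotient of the graded graph monoid by `I`. -/
noncomputable def quotientProj : ((V × ℤ) →₀ ℕ) →+ I.Quotient := I.con.mk'.comp (addConGen E.TalentedRel).mk'

theorem quotientProj_eq_zero {v : V} (hv : v ∈ vertexSet I) (i : ℤ) :
    quotientProj I (Finsupp.single (v, i) 1) = 0 :=
  (orderIdeal_mk_eq_zero I).2 ((mk_single_mem_iff I v i).2 hv)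

theorem quotientProj_kill (x : (V × ℤ) →₀ ℕ) :
    quotientProj I (kill (vertexSet I) x) = quotientProj I x := by
  refine DFunLike.congr_fun (f := (quotientProj I).comp (kill (vertexSet I)))
    (finsupp_nat_addHom_ext ?_) x
  rintro ⟨v, i⟩
  by_cases hv : v ∈ vertexSet I
  · simp [kill_of_mem hv, quotientProj_eq_zero I hv]
  · simp [kill_of_notMem hv]

/-- An expansion applies a defining relation and drops terms that are zero modulo `I`. So the
expansions of an element with nonzero class are nonzero. -/
theorem quotientProj_expandOnce (x : (V × ℤ) →₀ ℕ) :
    quotientProj I (expandOnce hE (vertexSet I) x) = quotientProj I x := by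
  refine DFunLike.congr_fun (f := (quotientProj I).comp (expandOnce hE (vertexSet I)))
    (finsupp_nat_addHom_ext ?_) x
  rintro ⟨v, i⟩
  simp only [AddMonoidHom.comp_apply]
  by_cases hv : v ∈ vertexSet I
  · simp [expandOnce_of_mem hE hv, quotientProj_eq_zero I hv]
  · by_cases hne : (E.outEdges v).Nonempty
    · rw [expandOnce_of_nonempty hE hv hne, map_sum]
      simp only [quotientProj_kill]
      have h1 := congrArg I.con.mk' (mk_single_eq_sum v i (hE _) hne)
      rw [map_sum] at h1
      exact h1.symm
    · rw [expandOnce_of_sink hE hv hne]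

theorem quotientProj_iterate (k : ℕ) (x : (V × ℤ) →₀ ℕ) :
    quotientProj I ((expandOnce hE (vertexSet I))^[k] x) = quotientProj I x := by
  induction k with
  | zero => rfl
  | succ k ih => rw [Function.iterate_succ_apply', quotientProj_expandOnce, ih]

theorem quotientProj_expandTo (k : ℤ) (x : (V × ℤ) →₀ ℕ) :
    quotientProj I (expandTo hE (vertexSet I) k x) = quotientProj I x := by
  refine DFunLike.congr_fun (f := (quotientProj I).comp (expandTo hE (vertexSet I) k))
    (finsupp_nat_addHom_ext ?_) x
  rintro ⟨v, i⟩
  simp only [AddMonoidHom.comp_apply]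
  rw [expandTo_single, quotientProj_iterate, quotientProj_kill]

/-- Equality in the quotient means `x + i = y + j` in the graded graph monoid with `i`, `j` in the
ideal, and these two expand to zero. -/
theorem eventually_expandTo_eq {x y : (V × ℤ) →₀ ℕ} (h : quotientProj I x = quotientProj I y) :
    ∀ᶠ k in atTop, expandTo hE (vertexSet I) k x = expandTo hE (vertexSet I) k y := by
  obtain ⟨i, hi, j, hj, hij⟩ := (AddCon.eq I.con).1 h
  induction i using AddCon.induction_on with | _ i
  induction j using AddCon.induction_on with | _ j
  have h2 := (hereditarySaturated_vertexSet hE I).addConGen_le_expandCon hE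
    ((AddCon.eq _).1 (hij : ((x + i : (V × ℤ) →₀ ℕ) : E.TalentedMonoid) = (y + j : (V × ℤ) →₀ ℕ)))
  have h3 : ∀ᶠ k in atTop, expandTo hE (vertexSet I) k (x + i) =
    expandTo hE (vertexSet I) k (y + j) := h2
  filter_upwards [h3] with k hk
  rwa [map_add, map_add, expandTo_eq_zero_of_mk_mem hE I hi, expandTo_eq_zero_of_mk_mem hE I hj,
    add_zero, add_zero] at hk

end vertexSet

/-! ### Counting terms under expansion -/

section degree

/-- The number of basis elements in an element of the free monoid. -/
noncomputable def size : ((V × ℤ) →₀ ℕ) →+ ℕ := basisExtend fun _ => 1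

theorem size_apply (x : (V × ℤ) →₀ ℕ) : size x = ∑ p ∈ x.support, x p := by
  simp [size, basisExtend_apply]

theorem size_single (p : V × ℤ) : size (Finsupp.single p 1) = 1 := basisExtend_single _ _

theorem size_freeShift (n : ℤ) (x : (V × ℤ) →₀ ℕ) : size (freeShift V n x) = size x := by
  refine DFunLike.congr_fun (f := size.comp (freeShift V n)) (finsupp_nat_addHom_ext ?_) x
  rintro ⟨v, i⟩
  simp [freeShift_single, size_single]

theorem addHom_apply_eq_sum {M : Type*} [AddCommMonoid M] (f : ((V × ℤ) →₀ ℕ) →+ M)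
    (x : (V × ℤ) →₀ ℕ) : f x = ∑ p ∈ x.support, x p • f (Finsupp.single p 1) := by
  conv_lhs => rw [← Finsupp.sum_single x, Finsupp.sum, map_sum]
  refine Finset.sum_congr rfl fun p _ => ?_
  rw [← map_nsmul]; simp

variable {H : Set V}

theorem apply_eq_zero_of_mem_kill {v : V} (hv : v ∈ H) (i : ℤ) (x : (V × ℤ) →₀ ℕ) :
    kill H x (v, i) = 0 := by
  rw [addHom_apply_eq_sum, Finsupp.finsetSum_apply]
  refine Finset.sum_eq_zero fun p _ => ?_
  obtain ⟨u, j⟩ := p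
  by_cases hu : u ∈ H
  · simp [kill_of_mem hu]
  · rw [kill_of_notMem hu, Finsupp.smul_apply, Finsupp.single_eq_of_ne, smul_zero]
    rintro ⟨rfl, rfl⟩
    exact hu hv

theorem apply_eq_zero_of_mem_expandOnce {v : V} (hv : v ∈ H) (i : ℤ) (x : (V × ℤ) →₀ ℕ) :
    expandOnce hE H x (v, i) = 0 := by
  rw [addHom_apply_eq_sum, Finsupp.finsetSum_apply]
  refine Finset.sum_eq_zero fun p _ => ?_
  rw [Finsupp.smul_apply]
  obtain ⟨u, j⟩ := p
  by_cases hu : u ∈ H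
  · simp [expandOnce_of_mem hE hu]
  · by_cases hne : (E.outEdges u).Nonempty
    · rw [expandOnce_of_nonempty hE hu hne, Finsupp.finsetSum_apply, Finset.sum_eq_zero, smul_zero]
      exact fun e _ => apply_eq_zero_of_mem_kill hv i _
    · rw [expandOnce_of_sink hE hu hne, Finsupp.single_eq_of_ne, smul_zero]
      rintro ⟨rfl, rfl⟩
      exact hu hv

theorem apply_eq_zero_of_mem_expandTo {v : V} (hv : v ∈ H) (i k : ℤ) (x : (V × ℤ) →₀ ℕ) :
    expandTo hE H k x (v, i) = 0 := by
  rw [addHom_apply_eq_sum, Finsupp.finsetSum_apply]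
  refine Finset.sum_eq_zero fun p _ => ?_
  rw [Finsupp.smul_apply, expandTo_single]
  rcases (k - p.2).toNat with _ | n
  · rw [Function.iterate_zero_apply, apply_eq_zero_of_mem_kill hv, smul_zero]
  · rw [Function.iterate_succ_apply', apply_eq_zero_of_mem_expandOnce hE hv, smul_zero]

/-- A vertex in the support of `x` leads, along an edge ending outside `H`, into the support of
the expansion of `x`. -/
theorem expandOnce_rng_ne_zero {x : (V × ℤ) →₀ ℕ} {v : V} {i : ℤ} (hx : x (v, i) ≠ 0)
    (hv : v ∉ H) {e : A} (he : E.src e = v) (hr : E.rng e ∉ H) :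
    expandOnce hE H x (E.rng e, i + 1) ≠ 0 := by
  rw [addHom_apply_eq_sum, Finsupp.finsetSum_apply]
  intro h0
  have h1 := Finset.sum_eq_zero_iff.1 h0 (v, i) (Finsupp.mem_support_iff.2 hx)
  rw [Finsupp.smul_apply, smul_eq_mul, mul_eq_zero, or_iff_right hx,
    expandOnce_of_nonempty hE hv ⟨e, he⟩, Finsupp.finsetSum_apply] at h1
  have h2 := Finset.sum_eq_zero_iff.1 h1 e (by simpa [outEdges] using he)
  rw [kill_of_notMem hr] at h2
  simp at h2

theorem expandOnce_sink_ne_zero {x : (V × ℤ) →₀ ℕ} {v : V} {i : ℤ} (hx : x (v, i) ≠ 0)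
    (hv : v ∉ H) (hne : ¬ (E.outEdges v).Nonempty) : expandOnce hE H x (v, i) ≠ 0 := by
  rw [addHom_apply_eq_sum, Finsupp.finsetSum_apply]
  intro h0
  have h1 := Finset.sum_eq_zero_iff.1 h0 (v, i) (Finsupp.mem_support_iff.2 hx)
  rw [Finsupp.smul_apply, smul_eq_mul, mul_eq_zero, or_iff_right hx,
    expandOnce_of_sink hE hv hne] at h1
  simp at h1

variable (hH : E.HereditarySaturated H)

include hH in
theorem exists_edge_notMem {v : V} (hv : v ∉ H) (hne : (E.outEdges v).Nonempty) :
    ∃ e, E.src e = v ∧ E.rng e ∉ H := by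
  by_contra! h
  exact hv (hH.src_mem v hne h)

include hH in
theorem one_le_size_expandOnce {v : V} (hv : v ∉ H) (i : ℤ) :
    1 ≤ size (expandOnce hE H (Finsupp.single (v, i) 1)) := by
  by_cases hne : (E.outEdges v).Nonempty
  · obtain ⟨e, he, hr⟩ := exists_edge_notMem hH hv hne
    rw [expandOnce_of_nonempty hE hv hne, map_sum]
    refine le_trans ?_ (Finset.single_le_sum (fun _ _ => Nat.zero_le _)
      (show e ∈ (hE v).toFinset by simpa [outEdges] using he))
    rw [kill_of_notMem hr, size_single]
  · rw [expandOnce_of_sink hE hv hne, size_single]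

theorem eq_of_size_expandOnce {v : V} (hv : v ∉ H) {i : ℤ}
    (h : size (expandOnce hE H (Finsupp.single (v, i) 1)) ≤ 1) {e f : A} (he : E.src e = v)
    (hf : E.src f = v) (her : E.rng e ∉ H) (hfr : E.rng f ∉ H) : e = f := by
  by_contra hne
  rw [expandOnce_of_nonempty hE hv ⟨e, he⟩, map_sum] at h
  classical
  have h1 := Finset.sum_le_sum_of_subset (f := fun g => size (kill H
    (Finsupp.single (E.rng g, i + 1) 1))) (show ({e, f} : Finset A) ⊆ (hE v).toFinset by
      intro g hg
      simp only [Finset.mem_insert, Finset.mem_singleton] at hg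
      rcases hg with rfl | rfl <;> simpa [outEdges])
  rw [Finset.sum_pair hne, kill_of_notMem her, kill_of_notMem hfr, size_single, size_single] at h1
  omega

include hH in
-- By saturation a non-sink outside `H` has an edge ending outside `H`, and a sink is kept, so every
-- term leaves at least one term.
theorem size_le_expandOnce {x : (V × ℤ) →₀ ℕ} (hx : ∀ v i, x (v, i) ≠ 0 → v ∉ H) :
    size x ≤ size (expandOnce hE H x) := by
  rw [size_apply, ← AddMonoidHom.comp_apply, addHom_apply_eq_sum]
  refine Finset.sum_le_sum fun p hp => ?_
  exact Nat.le_mul_of_pos_right _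
    (one_le_size_expandOnce hE hH (hx p.1 p.2 (Finsupp.mem_support_iff.1 hp)) p.2)

include hH in
theorem size_expandOnce_single_le_one {x : (V × ℤ) →₀ ℕ} (hx : ∀ v i, x (v, i) ≠ 0 → v ∉ H)
    (h : size (expandOnce hE H x) ≤ size x) {v : V} {i : ℤ} (hv : x (v, i) ≠ 0) :
    size (expandOnce hE H (Finsupp.single (v, i) 1)) ≤ 1 := by
  rw [size_apply x, ← AddMonoidHom.comp_apply, addHom_apply_eq_sum] at h
  by_contra! hlt
  refine absurd h (not_le.2 (Finset.sum_lt_sum (fun p hp => ?_)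
    ⟨(v, i), Finsupp.mem_support_iff.2 hv, ?_⟩))
  · exact Nat.le_mul_of_pos_right _
      (one_le_size_expandOnce hE hH (hx p.1 p.2 (Finsupp.mem_support_iff.1 hp)) p.2)
  · exact (Nat.lt_mul_iff_one_lt_right (Nat.pos_of_ne_zero hv)).2 hlt

theorem freeShift_apply (n : ℤ) (x : (V × ℤ) →₀ ℕ) (v : V) (i : ℤ) :
    freeShift V n x (v, i) = x (v, i - n) := by
  have hinj : Function.Injective fun p : V × ℤ => (p.1, p.2 + n) := by
    rintro ⟨a, b⟩ ⟨c, d⟩ h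
    simpa using h
  have := Finsupp.mapDomain_apply hinj x (v, i - n)
  simpa [freeShift] using! this

/-- The unique edges define a self-map of the finite set `W`, and an orbit of it must repeat. -/
theorem exists_cycle_of_finset {W : Finset V} (hW : W.Nonempty)
    (h : ∀ v ∈ W, v ∉ H ∧ ∃ e, E.src e = v ∧ E.rng e ∈ W ∧
      ∀ f, E.src f = v → E.rng f ∉ H → f = e) : ∃ e m, E.IsExitlessCycle H e m := by
  obtain ⟨w, hw⟩ := hW
  choose hnot edge hsrc hrng huniq using h
  let next : W → W := fun v => ⟨E.rng (edge v v.2), hrng v v.2⟩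
  let s : ℕ → W := fun i => next^[i] ⟨w, hw⟩
  have hs : ∀ i, s (i + 1) = next (s i) := fun i => Function.iterate_succ_apply' next i _
  obtain ⟨a, b, hab, heq⟩ : ∃ a b, a < b ∧ s a = s b := by
    obtain ⟨a, b, hab, heq⟩ := Finite.exists_ne_map_eq_of_infinite s
    rcases hab.lt_or_gt with h | h
    exacts [⟨a, b, h, heq⟩, ⟨b, a, h, heq.symm⟩]
  -- The orbit may enter its cycle only at time `a`, so indexing starts there; the length is the gap
  -- between the two equal visits.
  refine ⟨fun i => edge (s (a + i)) (s (a + i)).2, b - a, by omega, fun i => ?_, fun i => ?_,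
    fun i f hf hr => huniq _ _ f (hf.trans (hsrc _ _)) hr, ?_⟩
  · rw [hsrc, ← add_assoc, hs]
  · rw [hsrc]
    exact hnot _ (s (a + i)).2
  · rw [hsrc, hsrc, Nat.add_sub_cancel' hab.le, add_zero, heq]

include hH in
-- The size is monotone along the expansions and returns to its initial value after `n` of them,
-- hence is constant: each occurring vertex has at most one edge ending outside `H`. Once sinks are
-- excluded there is exactly one.
theorem exists_cycle_of_iterate_expandOnce {n : ℕ} (hn : 0 < n) {y : (V × ℤ) →₀ ℕ} (hy : y ≠ 0)
    (hyH : ∀ v i, y (v, i) ≠ 0 → v ∉ H)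
    (h : (expandOnce hE H)^[n] y = freeShift V n y) : ∃ e m, E.IsExitlessCycle H e m := by
  set Y : ℕ → ((V × ℤ) →₀ ℕ) := fun k => (expandOnce hE H)^[k] y with hY
  have hsucc : ∀ k, Y (k + 1) = expandOnce hE H (Y k) := fun k =>
    Function.iterate_succ_apply' _ _ _
  have hoff : ∀ k v i, Y k (v, i) ≠ 0 → v ∉ H := by
    rintro (_ | k) v i hk hv
    · exact hyH v i hk hv
    · rw [hsucc] at hk
      exact hk (apply_eq_zero_of_mem_expandOnce hE hv i _)
  have hmono : Monotone fun k => size (Y k) := monotone_nat_of_le_succ fun k => by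
    rw [hsucc]
    exact size_le_expandOnce hE hH (hoff k)
  have hsize : size (Y n) = size (Y 0) := by
    rw [show Y n = freeShift V n y from h, size_freeShift]; rfl
  have hle : ∀ k < n, size (expandOnce hE H (Y k)) ≤ size (Y k) := fun k hk => by
    rw [← hsucc]
    exact (hmono (Nat.succ_le_of_lt hk)).trans (hsize.le.trans (hmono (Nat.zero_le k)))
  have hback : ∀ v i, Y n (v, i) ≠ 0 → y (v, i - n) ≠ 0 := fun v i hk => by
    rwa [show Y n = freeShift V n y from h, freeShift_apply] at hk
  -- A sink stays at its level during expansion, while `Y n` is `y` shifted by `n`. A sink in `y` at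
  -- one level therefore also occurs `n` levels lower, and so on, against the finiteness of the
  -- support.
  have hsink : ∀ k ≤ n, ∀ v i, Y k (v, i) ≠ 0 → (E.outEdges v).Nonempty := by
    intro k hk v i hv
    by_contra hne
    have hpers : ∀ a b, Y a (v, b) ≠ 0 → ∀ t, Y (a + t) (v, b) ≠ 0 := by
      intro a b hab t
      induction t with
      | zero => exact hab
      | succ t ih =>
        rw [← add_assoc, hsucc]
        exact expandOnce_sink_ne_zero hE ih (hoff _ _ _ ih) hne
    have h0 : y (v, i - n) ≠ 0 := hback v i (by
      have := hpers k i hv (n - k)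
      rwa [Nat.add_sub_cancel' hk] at this)
    have hall : ∀ t : ℕ, y (v, i - n - t * n) ≠ 0 := by
      intro t
      induction t with
      | zero => simpa using h0
      | succ t ih =>
        have := hback _ _ (by simpa using hpers 0 _ ih n)
        rwa [show i - n - ((t + 1 : ℕ) : ℤ) * n = i - n - t * n - n by push_cast; ring]
    refine Set.infinite_of_injective_forall_mem (f := fun t : ℕ => (v, i - n - (t : ℤ) * n)) ?_
      (fun t => Finsupp.mem_support_iff.2 (hall t)) y.support.finite_toSet
    intro a b hab
    simpa [hn.ne'] using hab
  classical
  let W : Finset V := (Finset.range n).biUnion fun k => (Y k).support.image Prod.fst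
  have hW : ∀ v, v ∈ W ↔ ∃ k < n, ∃ i, Y k (v, i) ≠ 0 := by
    intro v
    simp [W]
  refine exists_cycle_of_finset (W := W) ?_ fun v hv => ?_
  · obtain ⟨p, hp⟩ := Finsupp.ne_iff.1 hy
    exact ⟨p.1, (hW _).2 ⟨0, hn, p.2, hp⟩⟩
  · obtain ⟨k, hk, i, hi⟩ := (hW v).1 hv
    have hvH := hoff k v i hi
    obtain ⟨e, he, hr⟩ := exists_edge_notMem hH hvH (hsink k hk.le v i hi)
    refine ⟨hvH, e, he, ?_, fun f hf hfr => ?_⟩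
    · have h1 := expandOnce_rng_ne_zero hE hi hvH he hr
      rw [← hsucc] at h1
      -- At `k + 1 = n` the set `W` wraps around: the vertices of `Y n` are those of `Y 0`.
      rcases (Nat.succ_le_of_lt hk).lt_or_eq with h2 | h2
      · exact (hW _).2 ⟨k + 1, h2, _, h1⟩
      · rw [show k + 1 = n from h2] at h1
        exact (hW _).2 ⟨0, hn, _, hback _ _ h1⟩
    · exact eq_of_size_expandOnce hE hvH
        (size_expandOnce_single_le_one hE hH (hoff k) (hle k hk) hi) hf he hfr hr

end degree

include hE in
theorem hasRelativelyExitlessCycle_of_isPeriodicElement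
    (I : OrderIdeal (Multiplicative ℤ) E.TalentedMonoid) (a : I.Quotient)
    (ha : IsPeriodicElement (Multiplicative ℤ) a) : E.HasRelativelyExitlessCycle := by
  obtain ⟨ha0, γ, hγ, hfix⟩ := ha
  -- Replacing `γ` by its inverse if necessary makes the period positive.
  obtain ⟨n, hn, hfix⟩ : ∃ n : ℕ, 0 < n ∧ Multiplicative.ofAdd (n : ℤ) • a = a := by
    have hγ' : γ.toAdd ≠ 0 := fun h => hγ (toAdd_eq_zero.1 h)
    rcases lt_or_gt_of_ne hγ' with h | h
    · refine ⟨γ.toAdd.natAbs, by omega, ?_⟩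
      have h1 : Multiplicative.ofAdd (γ.toAdd.natAbs : ℤ) = γ⁻¹ := by
        rw [Int.ofNat_natAbs_of_nonpos h.le]; rfl
      rw [h1, inv_smul_eq_iff, hfix]
    · refine ⟨γ.toAdd.natAbs, by omega, ?_⟩
      have h1 : Multiplicative.ofAdd (γ.toAdd.natAbs : ℤ) = γ := by
        rw [Int.natAbs_of_nonneg h.le]; rfl
      rw [h1, hfix]
  induction a using AddCon.induction_on with | _ a
  induction a using AddCon.induction_on with | _ x
  have hxx : quotientProj I (freeShift V n x) = quotientProj I x := hfix
  obtain ⟨K, hK⟩ := eventually_atTop.1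
    ((eventually_expandTo_eq hE I hxx).and (eventually_expandTo_succ hE (vertexSet I) x))
  have hiter : ∀ i : ℕ, (expandOnce hE (vertexSet I))^[i] (expandTo hE (vertexSet I) K x) =
      expandTo hE (vertexSet I) (K + i) x := by
    intro i
    induction i with
    | zero => simp
    | succ i ih =>
      rw [Function.iterate_succ_apply', ih, ← (hK _ (by omega)).2]
      push_cast
      rw [add_assoc]
  refine ⟨vertexSet I, hereditarySaturated_vertexSet hE I,
    exists_cycle_of_iterate_expandOnce hE (hereditarySaturated_vertexSet hE I) hn
      (y := expandTo hE (vertexSet I) K x) ?_ ?_ ?_⟩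
  · intro h0
    refine ha0 ?_
    have := quotientProj_expandTo hE I K x
    rw [h0, map_zero] at this
    exact this.symm
  · exact fun v i h hv => h (apply_eq_zero_of_mem_expandTo hE hv i K x)
  -- At level `K + n` the expansions of `x` and of its shift agree, and the latter is the shift of
  -- the expansion of `x` to level `K`.
  · rw [hiter, ← (hK _ (by omega)).1, expandTo_freeShift]

end DirGraph

/-! ### Relations and grading in the Leavitt path algebra -/

namespace DirGraph

section generators

variable {V : Type u} {A : Type w} (E : DirGraph V A) (F : Type x) [Field F]

/-- The vertex `v` as an element of the Leavitt path algebra. -/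
def lvert (v : V) : E.LeavittPathAlgebra F := E.leavittGen F (.vertex v)

/-- The edge `e` as an element of the Leavitt path algebra. -/
def ledge (e : A) : E.LeavittPathAlgebra F := E.leavittGen F (.edge e)

/-- The ghost edge `e*` as an element of the Leavitt path algebra. -/
def lghost (e : A) : E.LeavittPathAlgebra F := E.leavittGen F (.ghost e)

variable {E F}

theorem lvert_mul_self (v : V) : E.lvert F v * E.lvert F v = E.lvert F v :=
  Subtype.ext (by
    simpa [map_mul] using! RingQuot.mkAlgHom_rel F (LeavittRel.vertex_idem (E := E) (F := F) v))

theorem lvert_mul_of_ne {v u : V} (h : v ≠ u) : E.lvert F v * E.lvert F u = 0 :=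
  Subtype.ext (by
    simpa [map_mul] using!
      RingQuot.mkAlgHom_rel F (LeavittRel.vertex_orth (E := E) (F := F) v u h))

theorem lvert_src_mul_ledge (e : A) : E.lvert F (E.src e) * E.ledge F e = E.ledge F e :=
  Subtype.ext (by
    simpa [map_mul] using! RingQuot.mkAlgHom_rel F (LeavittRel.src_edge (E := E) (F := F) e))

theorem ledge_mul_lvert_rng (e : A) : E.ledge F e * E.lvert F (E.rng e) = E.ledge F e :=
  Subtype.ext (by
    simpa [map_mul] using! RingQuot.mkAlgHom_rel F (LeavittRel.edge_rng (E := E) (F := F) e))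

theorem lghost_mul_lvert_src (e : A) : E.lghost F e * E.lvert F (E.src e) = E.lghost F e :=
  Subtype.ext (by
    simpa [map_mul] using! RingQuot.mkAlgHom_rel F (LeavittRel.ghost_src (E := E) (F := F) e))

theorem lghost_mul_ledge_self (e : A) : E.lghost F e * E.ledge F e = E.lvert F (E.rng e) :=
  Subtype.ext (by
    simpa [map_mul] using! RingQuot.mkAlgHom_rel F (LeavittRel.ck1_same (E := E) (F := F) e))

theorem lghost_mul_ledge_of_ne {e f : A} (h : e ≠ f) : E.lghost F e * E.ledge F f = 0 :=
  Subtype.ext (by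
    simpa [map_mul] using! RingQuot.mkAlgHom_rel F (LeavittRel.ck1_ne (E := E) (F := F) e f h))

theorem lvert_eq_sum (v : V) (hfin : (E.outEdges v).Finite) (hne : (E.outEdges v).Nonempty) :
    E.lvert F v = ∑ e ∈ hfin.toFinset, E.ledge F e * E.lghost F e :=
  Subtype.ext (by
    have := RingQuot.mkAlgHom_rel F (LeavittRel.ck2 (E := E) (F := F) v hfin hne)
    simp only [map_sum, map_mul] at this
    rw [AddSubmonoidClass.coe_finsetSum]
    exact this)

theorem lvert_mem_component (v : V) : E.lvert F v ∈ E.leavittComponent F 0 :=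
  Submodule.subset_span (LeavittMonomial.gen (.vertex v))

theorem ledge_mem_component (e : A) : E.ledge F e ∈ E.leavittComponent F 1 :=
  Submodule.subset_span (LeavittMonomial.gen (.edge e))

theorem lghost_mem_component (e : A) : E.lghost F e ∈ E.leavittComponent F (-1) :=
  Submodule.subset_span (LeavittMonomial.gen (.ghost e))

theorem component_mul_mem {m n : ℤ} {y z : E.LeavittPathAlgebra F}
    (hy : y ∈ E.leavittComponent F m) (hz : z ∈ E.leavittComponent F n) :
    y * z ∈ E.leavittComponent F (m + n) := by
  induction hy using Submodule.span_induction with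
  | zero => rw [zero_mul]; exact zero_mem _
  | add a b _ _ ha hb => rw [add_mul]; exact add_mem ha hb
  | smul c a _ ha => rw [smul_mul_assoc]; exact Submodule.smul_mem _ c ha
  | mem y hy =>
    induction hz using Submodule.span_induction with
    | zero => rw [mul_zero]; exact zero_mem _
    | add a b _ _ ha hb => rw [mul_add]; exact add_mem ha hb
    | smul c a _ ha => rw [mul_smul_comm]; exact Submodule.smul_mem _ c ha
    | mem z hz => exact Submodule.subset_span (LeavittMonomial.mul hy hz)

/-- Induction principle for the Leavitt path algebra. -/
theorem leavitt_induction {P : E.LeavittPathAlgebra F → Prop} (hv : ∀ v, P (E.lvert F v))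
    (he : ∀ e, P (E.ledge F e)) (hg : ∀ e, P (E.lghost F e)) (h0 : P 0)
    (hadd : ∀ a b, P a → P b → P (a + b)) (hmul : ∀ a b, P a → P b → P (a * b))
    (hsmul : ∀ (c : F) a, P a → P (c • a)) (y : E.LeavittPathAlgebra F) : P y := by
  obtain ⟨y, hy⟩ := y
  induction hy using NonUnitalAlgebra.adjoin_induction with
  | mem y hy =>
    obtain ⟨g | e | e, rfl⟩ := hy
    exacts [hv g, he e, hg e]
  | zero => exact h0
  | add a b _ _ ha hb => exact hadd _ _ ha hb
  | mul a b _ _ ha hb => exact hmul _ _ ha hb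
  | smul c a _ ha => exact hsmul c _ ha

end generators

/-! ### Relatively exitless cycles give nongraded ideals, by actions on infinite paths -/

section representation

variable {V : Type u} {A : Type w} (E : DirGraph V A)

/-- The infinite paths avoiding `H`. -/
@[ext] structure PathsOff (H : Set V) : Type w where
  edge : ℕ → A
  isPath : ∀ i, E.rng (edge i) = E.src (edge (i + 1)) ∧ E.src (edge i) ∉ H

variable {E} {H : Set V}

/-- The infinite path without its first edge. -/
def PathsOff.tail (q : E.PathsOff H) : E.PathsOff H := ⟨fun i => q.edge (i + 1), fun i => q.2 (i + 1)⟩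

/-- The infinite path prolonged by a first edge. -/
def PathsOff.cons (hH : E.HereditarySaturated H) (e : A) (q : E.PathsOff H)
    (h : E.rng e = E.src (q.edge 0)) : E.PathsOff H :=
  ⟨fun i => Nat.casesOn i e q.edge, by
    rintro (_ | i)
    · exact ⟨h, fun hs => (q.2 0).2 (h ▸ hH.rng_mem e hs)⟩
    · exact q.2 i⟩

theorem PathsOff.cons_tail (hH : E.HereditarySaturated H) (q : E.PathsOff H) :
    PathsOff.cons hH (q.edge 0) q.tail (q.2 0).1 = q := by
  refine PathsOff.ext (funext fun i => ?_)
  cases i <;> rfl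

theorem PathsOff.tail_cons (hH : E.HereditarySaturated H) (e : A) (q : E.PathsOff H)
    (h : E.rng e = E.src (q.edge 0)) : (PathsOff.cons hH e q h).tail = q := rfl

variable (F : Type x) [Field F] {G : Type*} [AddCommGroup G] (γ : G)

open Classical in
/-- The vertex `v` acts as the projection onto the paths starting at `v`. -/
noncomputable def vertexOp (H : Set V) (G : Type*) (v : V) :
    Module.End F (E.PathsOff H × G → F) where
  toFun f p := if E.src (p.1.edge 0) = v then f p else 0
  map_add' f g := by ext p; simp only [Pi.add_apply]; split_ifs <;> simp
  map_smul' c f := by ext p; simp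

open Classical in
/-- The edge `e` acts by prolonging paths, multiplying by the grading parameter. -/
noncomputable def edgeOp (H : Set V) (e : A) : Module.End F (E.PathsOff H × G → F) where
  toFun f p := if p.1.edge 0 = e then f (p.1.tail, p.2 - γ) else 0
  map_add' f g := by ext p; simp only [Pi.add_apply]; split_ifs <;> simp
  map_smul' c f := by ext p; simp

open Classical in
/-- The ghost edge `e*` acts by removing first edges, dividing by the grading parameter. -/
noncomputable def ghostOp (hH : E.HereditarySaturated H) (e : A) :
    Module.End F (E.PathsOff H × G → F) where
  toFun f p := if h : E.rng e = E.src (p.1.edge 0) then f (p.1.cons hH e h, p.2 + γ) else 0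
  map_add' f g := by ext p; simp only [Pi.add_apply]; split_ifs <;> simp
  map_smul' c f := by ext p; simp

/-- The operators by which the generators act. -/
noncomputable def genOp (hH : E.HereditarySaturated H) :
    LeavittGen V A → Module.End F (E.PathsOff H × G → F)
  | .vertex v => vertexOp F H G v
  | .edge e => edgeOp F γ H e
  | .ghost e => ghostOp F γ hH e

omit [AddCommGroup G] in
open Classical in
theorem vertexOp_apply (v : V) (f : E.PathsOff H × G → F) (p : E.PathsOff H × G) :
    vertexOp F H G v f p = if E.src (p.1.edge 0) = v then f p else 0 := rfl

open Classical in
theorem edgeOp_apply (e : A) (f : E.PathsOff H × G → F) (p : E.PathsOff H × G) :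
    edgeOp F γ H e f p = if p.1.edge 0 = e then f (p.1.tail, p.2 - γ) else 0 := rfl

open Classical in
theorem ghostOp_apply (hH : E.HereditarySaturated H) (e : A) (f : E.PathsOff H × G → F)
    (p : E.PathsOff H × G) : ghostOp F γ hH e f p =
      if h : E.rng e = E.src (p.1.edge 0) then f (p.1.cons hH e h, p.2 + γ) else 0 := rfl

/-- The representation of the Leavitt path algebra on functions on infinite paths off `H`. -/
noncomputable def pathRep (hH : E.HereditarySaturated H) :
    E.LeavittUnitization F →ₐ[F] Module.End F (E.PathsOff H × G → F) :=
  RingQuot.liftAlgHom F ⟨FreeAlgebra.lift F (genOp F γ hH), by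
    intro a b hab
    induction hab with
    | vertex_idem v =>
      simp only [map_mul, FreeAlgebra.lift_ι_apply, genOp]
      ext f p
      simp only [Module.End.mul_apply, vertexOp_apply]
      split_ifs <;> rfl
    | vertex_orth v v' h =>
      simp only [map_mul, FreeAlgebra.lift_ι_apply, genOp, map_zero]
      ext f p
      simp only [Module.End.mul_apply, vertexOp_apply]
      split_ifs with h1 h2
      · exact absurd (h1.symm.trans h2) h
      all_goals rfl
    | src_edge e =>
      simp only [map_mul, FreeAlgebra.lift_ι_apply, genOp]
      ext f p
      simp only [Module.End.mul_apply, vertexOp_apply, edgeOp_apply]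
      split_ifs with h1 h2 h2
      · rfl
      · rfl
      · exact absurd (congrArg E.src h2) h1
      · rfl
    | edge_rng e =>
      simp only [map_mul, FreeAlgebra.lift_ι_apply, genOp]
      ext f p
      simp only [Module.End.mul_apply, vertexOp_apply, edgeOp_apply]
      split_ifs with h1 h2
      · rfl
      · exact absurd (h1 ▸ (p.1.2 0).1.symm) h2
      · rfl
    | rng_ghost e =>
      simp only [map_mul, FreeAlgebra.lift_ι_apply, genOp]
      ext f p
      simp only [Module.End.mul_apply, vertexOp_apply, ghostOp_apply]
      split_ifs with h1 h2 h2
      · rfl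
      · rfl
      · exact absurd h2.symm h1
      · rfl
    | ghost_src e =>
      simp only [map_mul, FreeAlgebra.lift_ι_apply, genOp]
      ext f p
      simp only [Module.End.mul_apply, vertexOp_apply, ghostOp_apply]
      split_ifs with h1 h2
      · rfl
      · exact absurd rfl h2
      · rfl
    | ck1_same e =>
      simp only [map_mul, FreeAlgebra.lift_ι_apply, genOp]
      ext f p
      simp only [Module.End.mul_apply, vertexOp_apply, edgeOp_apply, ghostOp_apply]
      by_cases h : E.rng e = E.src (p.1.edge 0)
      · have h0 : (p.1.cons hH e h).edge 0 = e := rfl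
        rw [dif_pos h, if_pos h0, if_pos h.symm, PathsOff.tail_cons, add_sub_cancel_right]
      · rw [dif_neg h, if_neg fun h' => h h'.symm]
    | ck1_ne e g h =>
      simp only [map_mul, FreeAlgebra.lift_ι_apply, genOp, map_zero]
      ext f p
      simp only [Module.End.mul_apply, edgeOp_apply, ghostOp_apply]
      split_ifs with h1 h2
      · exact absurd h2 h
      all_goals rfl
    | ck2 v hfin hne =>
      simp only [map_sum, map_mul, FreeAlgebra.lift_ι_apply, genOp]
      ext f p
      rw [LinearMap.sum_apply, Finset.sum_apply]
      simp only [Module.End.mul_apply, vertexOp_apply, edgeOp_apply, ghostOp_apply]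
      have h1 : E.rng (p.1.edge 0) = E.src (p.1.tail.edge 0) := (p.1.2 0).1
      by_cases hv : E.src (p.1.edge 0) = v
      -- An infinite path from `v` has exactly one first edge, so one summand survives and removes
      -- and restores that edge.
      · rw [if_pos hv, Finset.sum_eq_single (p.1.edge 0)]
        · rw [if_pos rfl, dif_pos h1, sub_add_cancel, PathsOff.cons_tail]
        · exact fun c _ hc => if_neg fun h => hc h.symm
        · exact fun h => absurd (by simpa [outEdges] using hv) h
      · rw [if_neg hv, Finset.sum_eq_zero]
        exact fun c hc => if_neg fun (h : p.1.edge 0 = c) =>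
          hv (h ▸ by simpa [outEdges] using hc)⟩

theorem pathRep_gen (hH : E.HereditarySaturated H) (g : LeavittGen V A) :
    pathRep F γ hH (E.leavittGenUnitization F g) = genOp F γ hH g := by
  rw [pathRep, leavittGenUnitization, RingQuot.liftAlgHom_mkAlgHom_apply,
    FreeAlgebra.lift_ι_apply]

variable {F}

/-- On homogeneous elements, the graded representation is determined by the ungraded one. -/
theorem pathRep_graded_apply (hH : E.HereditarySaturated H) {n : ℤ} {y : E.LeavittPathAlgebra F}
    (hy : y ∈ E.leavittComponent F n) (f : E.PathsOff H × ℤ → F) (q : E.PathsOff H) (k : ℤ) :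
    pathRep F (1 : ℤ) hH y.1 f (q, k) =
      pathRep F (0 : PUnit.{1}) hH y.1 (fun p => f (p.1, k - n)) (q, PUnit.unit) := by
  induction hy using Submodule.span_induction with
  | zero => simp
  | add a b _ _ ha hb => simp [ha, hb]
  | smul c a _ ha => simp [ha]
  | mem y hy =>
    have hy' : E.LeavittMonomial F n y := hy
    clear hy
    induction hy' generalizing f q k with
    | gen g =>
      change pathRep F (1 : ℤ) hH (E.leavittGenUnitization F g) f (q, k) =
        pathRep F (0 : PUnit.{1}) hH (E.leavittGenUnitization F g) _ _
      rw [pathRep_gen, pathRep_gen]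
      cases g with
      | vertex v => simp [genOp, vertexOp_apply, LeavittGen.degree]
      | edge e => simp [genOp, edgeOp_apply, LeavittGen.degree]
      | ghost e => simp [genOp, ghostOp_apply, LeavittGen.degree]
    | @mul m n y z _ _ ihy ihz =>
      simp only [NonUnitalSubalgebra.coe_mul, map_mul, Module.End.mul_apply]
      rw [ihy]
      refine congrFun (congrArg _ (funext fun p => ?_)) _
      rw [ihz, sub_sub]

/-- Each edge of a path off `H` ends outside `H`, since the next source is there; so it can never
leave the cycle. -/
theorem IsExitlessCycle.path_eq {e : ℕ → A} {m : ℕ} (hc : E.IsExitlessCycle H e m)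
    (q : E.PathsOff H) (h : E.src (q.edge 0) = E.src (e 0)) (i : ℕ) : q.edge i = e i := by
  have key : ∀ i, E.src (q.edge i) = E.src (e i) → q.edge i = e i := fun i hi =>
    hc.eq_of_src_eq i _ hi ((q.2 i).1 ▸ (q.2 (i + 1)).2)
  induction i with
  | zero => exact key 0 h
  | succ i ih => exact key _ (by rw [← (q.2 i).1, ih, hc.rng_eq])

/-- The path `e 0 ⋯ e (k - 1)` in the Leavitt path algebra. -/
noncomputable def initialPath (E : DirGraph V A) (F : Type x) [Field F] (e : ℕ → A) :
    ℕ → E.LeavittPathAlgebra F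
  | 0 => E.lvert F (E.src (e 0))
  | k + 1 => initialPath E F e k * E.ledge F (e k)

/-- The infinite path without its first `k` edges. -/
def PathsOff.drop (q : E.PathsOff H) (k : ℕ) : E.PathsOff H :=
  ⟨fun i => q.edge (i + k), fun i => by
    have := q.2 (i + k)
    rwa [add_right_comm] at this⟩

open Classical in
-- By `path_eq`, a path off `H` from the start of the cycle automatically begins with `e 0 ⋯ e (k -
-- 1)`, so no condition beyond the starting vertex remains.
theorem pathRep_initialPath (hH : E.HereditarySaturated H) {e : ℕ → A} {m : ℕ}
    (hc : E.IsExitlessCycle H e m) (k : ℕ) (f : E.PathsOff H × G → F) (q : E.PathsOff H) (g : G) :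
    pathRep F γ hH (initialPath E F e k).1 f (q, g) =
      if E.src (q.edge 0) = E.src (e 0) then f (q.drop k, g - k • γ) else 0 := by
  induction k generalizing f with
  | zero =>
    have h1 : (initialPath E F e 0).1 = E.leavittGenUnitization F (.vertex (E.src (e 0))) := rfl
    rw [h1, pathRep_gen, genOp, vertexOp_apply, zero_smul, sub_zero]
    rfl
  | succ k ih =>
    have h1 : (initialPath E F e (k + 1)).1 =
      (initialPath E F e k).1 * E.leavittGenUnitization F (.edge (e k)) := rfl
    rw [h1, map_mul, Module.End.mul_apply, ih, pathRep_gen, genOp]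
    refine if_ctx_congr Iff.rfl (fun h => ?_) fun _ => rfl
    rw [edgeOp_apply, if_pos]
    · rw [sub_sub, ← succ_nsmul]
      congr 2
      refine PathsOff.ext (funext fun i => congrArg q.edge ?_)
      omega
    · change q.edge (0 + k) = e k
      rw [zero_add, hc.path_eq q h]

theorem exists_not_isGradedIdeal (h : E.HasRelativelyExitlessCycle) (F : Type x) [Field F] :
    ∃ J : TwoSidedIdeal (E.LeavittPathAlgebra F), ¬ E.IsGradedIdeal F J := by
  -- The ideal is the kernel of the action with trivial grading group; the action with group `ℤ` and
  -- parameter `1` serves to detect that it is not graded.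
  obtain ⟨H, hH, e, m, hc⟩ := h
  let J : TwoSidedIdeal (E.LeavittPathAlgebra F) := .mk'
    {y | pathRep F (0 : PUnit.{1}) hH y.1 = 0} (map_zero _)
    (fun {y z} hy hz => by
      change pathRep F (0 : PUnit.{1}) hH (y.1 + z.1) = 0
      rw [map_add, hy, hz, add_zero])
    (fun {y} hy => by
      change pathRep F (0 : PUnit.{1}) hH (-y.1) = 0
      rw [map_neg, hy, neg_zero])
    (fun {y z} hz => by
      change pathRep F (0 : PUnit.{1}) hH (y.1 * z.1) = 0
      rw [map_mul, hz, mul_zero])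
    (fun {y z} hy => by
      change pathRep F (0 : PUnit.{1}) hH (y.1 * z.1) = 0
      rw [map_mul, hy, zero_mul])
  have hJ : ∀ y, y ∈ J ↔ pathRep F (0 : PUnit.{1}) hH y.1 = 0 := fun y =>
    TwoSidedIdeal.mem_mk' _ _ _ _ _ _ _
  let q : E.PathsOff H := ⟨e, fun i => ⟨hc.rng_eq i, hc.src_notMem i⟩⟩
  have hloop : ∀ p : E.PathsOff H, E.src (p.edge 0) = E.src (e 0) → p.drop m = p := by
    intro p hp
    have h1 : E.src ((p.drop m).edge 0) = E.src (e 0) := by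
      change E.src (p.edge (0 + m)) = _
      rw [zero_add, hc.path_eq p hp, hc.src_closed]
    exact PathsOff.ext (funext fun i => (hc.path_eq _ h1 i).trans (hc.path_eq p hp i).symm)
  set y : E.LeavittPathAlgebra F := initialPath E F e 0 - initialPath E F e m with hy
  have hyJ : y ∈ J := by
    rw [hJ]
    ext f ⟨p, g⟩
    rw [hy, AddSubgroupClass.coe_sub, map_sub, LinearMap.sub_apply, Pi.sub_apply,
      pathRep_initialPath _ _ hc, pathRep_initialPath _ _ hc, LinearMap.zero_apply, Pi.zero_apply]
    split_ifs with h
    · rw [hloop p h]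
      exact sub_self _
    · exact sub_self _
  refine ⟨J, fun hgr => ?_⟩
  have hker : pathRep F (1 : ℤ) hH y.1 = 0 := by
    have hcl := hgr y hyJ
    clear_value y
    clear hy hyJ
    induction hcl using AddSubmonoid.closure_induction with
    | zero => exact map_zero _
    | add a b _ _ ha hb =>
      change pathRep F (1 : ℤ) hH (a.1 + b.1) = 0
      rw [map_add, ha, hb, add_zero]
    | mem z hz =>
      obtain ⟨hzJ, n, hn⟩ := hz
      ext f ⟨p, k⟩
      rw [pathRep_graded_apply hH hn, (hJ z).1 hzJ]
      rfl
  -- On the indicator of level `0`, evaluated at the cycle at level `0`, the vertex gives `1` and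
  -- the cycle, which reads level `-m`, gives `0`.
  have h1 := congrFun (DFunLike.congr_fun hker fun p => if p.2 = 0 then (1 : F) else 0) (q, 0)
  rw [hy, AddSubgroupClass.coe_sub, map_sub, LinearMap.sub_apply, Pi.sub_apply,
    pathRep_initialPath _ _ hc, pathRep_initialPath _ _ hc, if_pos rfl, if_pos rfl] at h1
  have hm : (m : ℤ) ≠ 0 := by exact_mod_cast hc.pos.ne'
  simp [hc.pos.ne'] at h1

end representation

end DirGraph

/-! ### Multiplying by real paths to remove ghost edges -/

namespace DirGraph

variable {V : Type u} {A : Type w} {E : DirGraph V A} {F : Type x} [Field F]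

section realPaths

/-- The product in the Leavitt path algebra of a list of edges and the vertex `v`. -/
noncomputable def realPath (E : DirGraph V A) (F : Type x) [Field F] (v : V) :
    List A → E.LeavittPathAlgebra F
  | [] => E.lvert F v
  | e :: l => E.ledge F e * realPath E F v l

theorem realPath_mul_lvert (v : V) (l : List A) :
    realPath E F v l * E.lvert F v = realPath E F v l := by
  induction l with
  | nil => exact lvert_mul_self v
  | cons e l ih => rw [realPath, mul_assoc, ih]

theorem lvert_mul_ledge_of_ne {u : V} {e : A} (h : u ≠ E.src e) :
    E.lvert F u * E.ledge F e = 0 := by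
  rw [← lvert_src_mul_ledge, ← mul_assoc, lvert_mul_of_ne h, zero_mul]

theorem lghost_mul_lvert_of_ne {u : V} {e : A} (h : E.src e ≠ u) :
    E.lghost F e * E.lvert F u = 0 := by
  rw [← lghost_mul_lvert_src, mul_assoc, lvert_mul_of_ne h, mul_zero]

/-- Lists of edges need not be composable; dichotomies of this kind avoid tracking composability. -/
theorem lvert_mul_realPath (u v : V) (l : List A) :
    E.lvert F u * realPath E F v l = 0 ∨ E.lvert F u * realPath E F v l = realPath E F v l := by
  cases l with
  | nil =>
    by_cases h : u = v
    · exact Or.inr (by rw [realPath, h, lvert_mul_self])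
    · exact Or.inl (lvert_mul_of_ne h)
  | cons e l =>
    by_cases h : u = E.src e
    · exact Or.inr (by rw [realPath, ← mul_assoc, h, lvert_src_mul_ledge])
    · exact Or.inl (by rw [realPath, ← mul_assoc, lvert_mul_ledge_of_ne h, zero_mul])

theorem lvert_rng_mul_realPath_of_ledge (e : A) (v : V) (l : List A) :
    E.ledge F e * (E.lvert F (E.rng e) * realPath E F v l) = E.ledge F e * realPath E F v l := by
  rw [← mul_assoc, ledge_mul_lvert_rng]

theorem realPath_mul_ledge (e : A) (l : List A) :
    realPath E F (E.src e) l * E.ledge F e = realPath E F (E.rng e) (l ++ [e]) := by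
  induction l with
  | nil => exact (lvert_src_mul_ledge e).trans (ledge_mul_lvert_rng e).symm
  | cons f l ih => rw [List.cons_append, realPath, realPath, mul_assoc, ih]

theorem lghost_mul_realPath_cons_self (e : A) (v : V) (l : List A) :
    E.lghost F e * realPath E F v (e :: l) = E.lvert F (E.rng e) * realPath E F v l := by
  rw [realPath, ← mul_assoc, lghost_mul_ledge_self]

theorem lghost_mul_realPath_cons_of_ne {e f : A} (h : e ≠ f) (v : V) (l : List A) :
    E.lghost F e * realPath E F v (f :: l) = 0 := by
  rw [realPath, ← mul_assoc, lghost_mul_ledge_of_ne h, zero_mul]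

theorem lghost_mul_realPath_cons (e f : A) (v : V) (l : List A) :
    E.lghost F e * realPath E F v (f :: l) = 0 ∨
      E.lghost F e * realPath E F v (f :: l) = realPath E F v l := by
  by_cases h : e = f
  · rw [← h, lghost_mul_realPath_cons_self]
    exact lvert_mul_realPath _ _ _
  · exact Or.inl (lghost_mul_realPath_cons_of_ne h v l)

/-- The ghost edge strips a leading `e` and the edge appends it at the end. This rotation drives the
final argument. -/
theorem lghost_mul_realPath_mul_ledge (e : A) {l : List A} (hl : l ≠ []) :
    E.lghost F e * realPath E F (E.src e) l * E.ledge F e = 0 ∨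
      ((∃ l', l = e :: l') ∧ E.lghost F e * realPath E F (E.src e) l * E.ledge F e =
        realPath E F (E.rng e) (l.rotate 1)) := by
  obtain ⟨f, l, rfl⟩ := List.exists_cons_of_ne_nil hl
  by_cases h : e = f
  · subst h
    rw [lghost_mul_realPath_cons_self, mul_assoc, realPath_mul_ledge]
    refine (lvert_mul_realPath (E.rng e) (E.rng e) (l ++ [e])).imp_right fun h => ⟨⟨l, rfl⟩, ?_⟩
    rw [h]
    simp
  · exact Or.inl (by rw [lghost_mul_realPath_cons_of_ne h, zero_mul])

theorem realPath_mem_component (v : V) (l : List A) :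
    realPath E F v l ∈ E.leavittComponent F l.length := by
  induction l with
  | nil => exact lvert_mem_component v
  | cons e l ih =>
    have := component_mul_mem (ledge_mem_component e) ih
    rwa [add_comm] at this

/-- Every element has the sum of any sufficiently large finite set of vertices as right unit. -/
theorem exists_mul_sum_lvert (y : E.LeavittPathAlgebra F) :
    ∃ S : Finset V, ∀ S', S ⊆ S' → ∑ v ∈ S', y * E.lvert F v = y := by
  classical
  have key : ∀ (y : E.LeavittPathAlgebra F) v, y * E.lvert F v = y →
      ∃ S : Finset V, ∀ S', S ⊆ S' → ∑ v ∈ S', y * E.lvert F v = y := by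
    refine fun y v h => ⟨{v}, fun S' hS => ?_⟩
    rw [Finset.sum_eq_single_of_mem v (hS (Finset.mem_singleton_self v)), h]
    intro u _ hu
    rw [← h, mul_assoc, lvert_mul_of_ne hu.symm, mul_zero]
  induction y using leavitt_induction with
  | hv v => exact key _ v (lvert_mul_self v)
  | he e => exact key _ _ (ledge_mul_lvert_rng e)
  | hg e => exact key _ _ (lghost_mul_lvert_src e)
  | h0 => exact ⟨∅, fun S' _ => by simp⟩
  | hadd a b ha hb =>
    obtain ⟨S, hS⟩ := ha
    obtain ⟨T, hT⟩ := hb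
    refine ⟨S ∪ T, fun S' h => ?_⟩
    simp only [add_mul, Finset.sum_add_distrib]
    rw [hS S' (Finset.union_subset_left h), hT S' (Finset.union_subset_right h)]
  | hmul a b _ hb =>
    obtain ⟨T, hT⟩ := hb
    refine ⟨T, fun S' h => ?_⟩
    simp only [mul_assoc]
    rw [← Finset.mul_sum, hT S' h]
  | hsmul c a ha =>
    obtain ⟨S, hS⟩ := ha
    refine ⟨S, fun S' h => ?_⟩
    simp only [smul_mul_assoc]
    rw [← Finset.smul_sum, hS S' h]

/-- The list `l` has length at least `k`, or `v` is a sink. -/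
def LongOrSink (E : DirGraph V A) (k : ℕ) (v : V) (l : List A) : Prop :=
  k ≤ l.length ∨ ¬ (E.outEdges v).Nonempty

theorem LongOrSink.mono {k m : ℕ} {v : V} {l : List A} (h : E.LongOrSink k v l) (hm : m ≤ k) :
    E.LongOrSink m v l := h.imp_left hm.trans

/-- Right multiplication by sufficiently long paths removes all ghost edges. -/
theorem exists_mul_realPath_mem_span (y : E.LeavittPathAlgebra F) (m : ℕ) :
    ∃ n, ∀ v l, E.LongOrSink n v l →
      y * realPath E F v l ∈ Submodule.span F (realPath E F v '' {l | E.LongOrSink m v l}) := by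
  induction y using leavitt_induction generalizing m with
  | hv u =>
    refine ⟨m, fun v l h => ?_⟩
    rcases lvert_mul_realPath (E := E) (F := F) u v l with h' | h' <;> rw [h']
    · exact zero_mem _
    · exact Submodule.subset_span ⟨l, h, rfl⟩
  | he e =>
    exact ⟨m, fun v l h => Submodule.subset_span ⟨e :: l, h.imp_left fun h => h.trans (by simp),
      rfl⟩⟩
  | hg e =>
    refine ⟨m + 1, fun v l h => ?_⟩
    cases l with
    | nil =>
      -- An empty list is admitted here only at a sink, where no ghost edge can act nontrivially.
      have hv : ¬ (E.outEdges v).Nonempty := h.resolve_left (by simp)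
      have h0 : E.lghost F e * realPath E F v [] = 0 :=
        lghost_mul_lvert_of_ne fun h => hv ⟨e, h⟩
      rw [h0]
      exact zero_mem _
    | cons f l =>
      rcases lghost_mul_realPath_cons (E := E) (F := F) e f v l with h' | h' <;> rw [h']
      · exact zero_mem _
      · exact Submodule.subset_span ⟨l, h.imp_left fun h => by simpa using h, rfl⟩
  | h0 => exact ⟨0, fun v l _ => by rw [zero_mul]; exact zero_mem _⟩
  | hadd a b ha hb =>
    obtain ⟨n, hn⟩ := ha m
    obtain ⟨k, hk⟩ := hb m
    refine ⟨max n k, fun v l h => ?_⟩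
    rw [add_mul]
    exact add_mem (hn v l (h.mono (le_max_left _ _))) (hk v l (h.mono (le_max_right _ _)))
  -- The factor `b` must leave paths long enough for `a`, so the bound `n` for `a` becomes the
  -- target length for `b`; this is why the induction generalizes `m`.
  | hmul a b ha hb =>
    obtain ⟨n, hn⟩ := ha m
    obtain ⟨k, hk⟩ := hb n
    refine ⟨k, fun v l h => ?_⟩
    rw [mul_assoc]
    generalize b * realPath E F v l = z, hk v l h = hz
    induction hz using Submodule.span_induction with
    | zero => rw [mul_zero]; exact zero_mem _
    | add y z _ _ hy hz => rw [mul_add]; exact add_mem hy hz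
    | smul c y _ hy => rw [mul_smul_comm]; exact Submodule.smul_mem _ c hy
    | mem y hy =>
      obtain ⟨l', hl', rfl⟩ := hy
      exact hn v l' hl'
  | hsmul c a ha =>
    obtain ⟨n, hn⟩ := ha m
    refine ⟨n, fun v l h => ?_⟩
    rw [smul_mul_assoc]
    exact Submodule.smul_mem _ c (hn v l h)

theorem exists_sum_ledge_mul_lghost_mul {v : V} {y : E.LeavittPathAlgebra F}
    (hy : y ∈ Submodule.span F (realPath E F v '' {l | l ≠ []})) :
    ∃ S : Finset A, ∀ S', S ⊆ S' → ∑ e ∈ S', E.ledge F e * (E.lghost F e * y) = y := by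
  classical
  induction hy using Submodule.span_induction with
  | zero => exact ⟨∅, fun S' _ => by simp⟩
  | add a b _ _ ha hb =>
    obtain ⟨S, hS⟩ := ha
    obtain ⟨T, hT⟩ := hb
    refine ⟨S ∪ T, fun S' h => ?_⟩
    simp only [mul_add, Finset.sum_add_distrib]
    rw [hS S' (Finset.union_subset_left h), hT S' (Finset.union_subset_right h)]
  | smul c a _ ha =>
    obtain ⟨S, hS⟩ := ha
    refine ⟨S, fun S' h => ?_⟩
    simp only [mul_smul_comm]
    rw [← Finset.smul_sum, hS S' h]
  | mem y hy =>
    obtain ⟨l, hl, rfl⟩ := hy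
    obtain ⟨f, l, rfl⟩ := List.exists_cons_of_ne_nil hl
    refine ⟨{f}, fun S' h => ?_⟩
    rw [Finset.sum_eq_single_of_mem f (h (Finset.mem_singleton_self f)),
      lghost_mul_realPath_cons_self, lvert_rng_mul_realPath_of_ledge]
    · rfl
    · intro e _ he
      rw [lghost_mul_realPath_cons_of_ne he, mul_zero]

end realPaths

/-! ### Staying outside the graded part of an ideal -/

section gradedPart

variable (J : TwoSidedIdeal (E.LeavittPathAlgebra F))

/-- The sums of homogeneous elements of an ideal. -/
def gradedPart : AddSubmonoid (E.LeavittPathAlgebra F) :=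
  AddSubmonoid.closure {z | z ∈ J ∧ ∃ n : ℤ, z ∈ E.leavittComponent F n}

variable {J}

theorem mul_mem_gradedPart_right {y z : E.LeavittPathAlgebra F} {n : ℤ} (hy : y ∈ gradedPart J)
    (hz : z ∈ E.leavittComponent F n) : y * z ∈ gradedPart J := by
  induction hy using AddSubmonoid.closure_induction with
  | zero => rw [zero_mul]; exact zero_mem _
  | add a b _ _ ha hb => rw [add_mul]; exact add_mem ha hb
  | mem y hy =>
    obtain ⟨hyJ, m, hm⟩ := hy
    exact AddSubmonoid.subset_closure ⟨J.mul_mem_right _ _ hyJ, _, component_mul_mem hm hz⟩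

theorem mul_mem_gradedPart_left {y z : E.LeavittPathAlgebra F} {n : ℤ} (hy : y ∈ gradedPart J)
    (hz : z ∈ E.leavittComponent F n) : z * y ∈ gradedPart J := by
  induction hy using AddSubmonoid.closure_induction with
  | zero => rw [mul_zero]; exact zero_mem _
  | add a b _ _ ha hb => rw [mul_add]; exact add_mem ha hb
  | mem y hy =>
    obtain ⟨hyJ, m, hm⟩ := hy
    exact AddSubmonoid.subset_closure ⟨J.mul_mem_left _ _ hyJ, _, component_mul_mem hz hm⟩

/-- If every one-edge extension of the path led into the graded part, then `v = ∑ e e*` would put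
the unextended product there too. At a sink no extension is needed; the start is a local unit. -/
theorem exists_mul_realPath_notMem (hE : E.RowFinite) {y : E.LeavittPathAlgebra F}
    (hy : y ∉ gradedPart J) (k : ℕ) :
    ∃ v l, E.LongOrSink k v l ∧ y * realPath E F v l ∉ gradedPart J := by
  induction k with
  | zero =>
    by_contra! h
    obtain ⟨S, hS⟩ := exists_mul_sum_lvert y
    refine hy (hS S subset_rfl ▸ sum_mem fun v _ => ?_)
    exact h v [] (Or.inl (Nat.zero_le _))
  | succ k ih =>
    obtain ⟨v, l, hl, hyl⟩ := ih
    by_cases hv : (E.outEdges v).Nonempty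
    · by_contra! h
      refine hyl ?_
      rw [← realPath_mul_lvert, lvert_eq_sum v (hE v) hv, Finset.mul_sum, Finset.mul_sum]
      refine sum_mem fun e he => ?_
      have hs : E.src e = v := by simpa [outEdges] using he
      subst hs
      rw [← mul_assoc, ← mul_assoc, mul_assoc y, realPath_mul_ledge]
      refine mul_mem_gradedPart_right (h _ _ (Or.inl ?_)) (lghost_mem_component e)
      have := hl.resolve_right (not_not.2 hv)
      simpa using this
    · exact ⟨v, l, Or.inr hv, hyl⟩

theorem mem_gradedPart_of_lvert_mem {v : V} (hv : E.lvert F v ∈ J) {y : E.LeavittPathAlgebra F}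
    (hy : y ∈ Submodule.span F (Set.range (realPath E F v))) : y ∈ gradedPart J := by
  induction hy using Submodule.span_induction with
  | zero => exact zero_mem _
  | add a b _ _ ha hb => exact add_mem ha hb
  | smul c a ha ih =>
    -- The graded part is only an additive submonoid, so the scalar is realised as right
    -- multiplication by the homogeneous element `c • v`.
    have hh : c • E.lvert F v ∈ E.leavittComponent F 0 :=
      Submodule.smul_mem _ c (lvert_mem_component v)
    have h1 := mul_mem_gradedPart_right ih hh
    have h2 : a * E.lvert F v = a := by
      clear ih h1
      induction ha using Submodule.span_induction with
      | zero => rw [zero_mul]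
      | add a b _ _ ha hb => rw [add_mul, ha, hb]
      | smul c a _ ha => rw [smul_mul_assoc, ha]
      | mem a ha =>
        obtain ⟨l, rfl⟩ := ha
        exact realPath_mul_lvert v l
    rwa [mul_smul_comm, h2] at h1
  | mem y hy =>
    obtain ⟨l, rfl⟩ := hy
    refine AddSubmonoid.subset_closure ⟨?_, _, realPath_mem_component v l⟩
    rw [← realPath_mul_lvert]
    exact J.mul_mem_left _ _ hv

/-- Left multiplication by ghost edges produces an element with nonzero constant term. -/
theorem exists_smul_lvert_add_mem {v : V} (N : ℕ) {y : E.LeavittPathAlgebra F} (hyJ : y ∈ J)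
    (hy : y ∉ gradedPart J)
    (hyN : y ∈ Submodule.span F (realPath E F v '' {l | l.length < N})) :
    ∃ c : F, c ≠ 0 ∧ ∃ z ∈ Submodule.span F (realPath E F v '' {l | l ≠ []}),
      c • E.lvert F v + z ∈ J := by
  induction N generalizing y with
  | zero =>
    simp only [Nat.not_lt_zero, Set.ofPred_false, Set.image_empty, Submodule.span_empty,
      Submodule.mem_bot] at hyN
    exact absurd (hyN ▸ zero_mem _) hy
  | succ N ih =>
    have hsub : realPath E F v '' {l | l.length < N + 1} ⊆
        insert (E.lvert F v) (realPath E F v '' {l | l ≠ [] ∧ l.length < N + 1}) := by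
      rintro _ ⟨l, hl, rfl⟩
      by_cases h : l = []
      · exact Or.inl (by rw [h]; rfl)
      · exact Or.inr ⟨l, ⟨h, hl⟩, rfl⟩
    obtain ⟨c, z, hz, rfl⟩ := Submodule.mem_span_insert.1 (Submodule.span_mono hsub hyN)
    have hz' : z ∈ Submodule.span F (realPath E F v '' {l | l ≠ []}) :=
      Submodule.span_mono (Set.image_mono fun l hl => hl.1) hz
    -- Without constant term, `z = ∑ e (e* z)`, so some `e* z` is still outside the graded part, and
    -- its paths are shorter by one edge.
    by_cases hc : c = 0
    · subst hc
      rw [zero_smul, zero_add] at hyJ hy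
      obtain ⟨S, hS⟩ := exists_sum_ledge_mul_lghost_mul hz'
      obtain ⟨e, he⟩ : ∃ e, E.lghost F e * z ∉ gradedPart J := by
        by_contra! h
        exact hy (hS S subset_rfl ▸
          sum_mem fun e _ => mul_mem_gradedPart_left (h e) (ledge_mem_component e))
      refine ih (J.mul_mem_left _ _ hyJ) he ?_
      clear hyJ hy he hS hz' hyN
      induction hz using Submodule.span_induction with
      | zero => rw [mul_zero]; exact zero_mem _
      | add a b _ _ ha hb => rw [mul_add]; exact add_mem ha hb
      | smul c a _ ha => rw [mul_smul_comm]; exact Submodule.smul_mem _ c ha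
      | mem y hy =>
        obtain ⟨l, ⟨hl, hlN⟩, rfl⟩ := hy
        obtain ⟨f, l, rfl⟩ := List.exists_cons_of_ne_nil hl
        rcases lghost_mul_realPath_cons (E := E) (F := F) e f v l with h' | h' <;> rw [h']
        · exact zero_mem _
        · exact Submodule.subset_span ⟨l, by simpa using hlN, rfl⟩
    · exact ⟨c, hc, z, hz', hyJ⟩

end gradedPart

/-! ### Minimal reduced elements and the cycle they trace -/

section reduction

/-- The linear combination of paths with range `v` given by a list of coefficients and paths. -/
noncomputable def pathComb (E : DirGraph V A) (v : V) (L : List (F × List A)) :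
    E.LeavittPathAlgebra F :=
  (L.map fun c => c.1 • realPath E F v c.2).sum

theorem pathComb_cons (v : V) (c : F × List A) (L : List (F × List A)) :
    pathComb E v (c :: L) = c.1 • realPath E F v c.2 + pathComb E v L := by
  simp [pathComb]

/-- A list of terms, unlike membership in a span, has a length that can be minimised. -/
theorem exists_pathComb_eq {v : V} {y : E.LeavittPathAlgebra F}
    (hy : y ∈ Submodule.span F (realPath E F v '' {l | l ≠ []})) :
    ∃ L : List (F × List A), (∀ c ∈ L, c.2 ≠ []) ∧ pathComb E v L = y := by
  induction hy using Submodule.span_induction with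
  | zero => exact ⟨[], by simp, rfl⟩
  | add a b _ _ ha hb =>
    obtain ⟨L, hL, rfl⟩ := ha
    obtain ⟨M, hM, rfl⟩ := hb
    refine ⟨L ++ M, fun c hc => ?_, by simp [pathComb]⟩
    exact (List.mem_append.1 hc).elim (hL c) (hM c)
  | smul d a _ ha =>
    obtain ⟨L, hL, rfl⟩ := ha
    refine ⟨L.map fun c => (d * c.1, c.2), fun c hc => ?_, ?_⟩
    · obtain ⟨c', hc', rfl⟩ := List.mem_map.1 hc
      exact hL c' hc'
    · simp [pathComb, List.smul_sum, Function.comp_def, mul_smul]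
  | mem y hy =>
    obtain ⟨l, hl, rfl⟩ := hy
    exact ⟨[(1, l)], by simpa using hl, by simp [pathComb]⟩

variable (J : TwoSidedIdeal (E.LeavittPathAlgebra F))

/-- The ideal `J` does not contain `v`, but a nonzero multiple of `v` plus the given linear
combination of paths of positive length with range `v`. -/
structure IsReduced (v : V) (L : List (F × List A)) : Prop where
  notMem : E.lvert F v ∉ J
  ne_nil : ∀ c ∈ L, c.2 ≠ []
  exists_mem : ∃ c : F, c ≠ 0 ∧ c • E.lvert F v + pathComb E v L ∈ J

/-- Right multiplication by a long path removes the ghost edges from an element of `J` outside the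
graded part; left multiplication by ghost edges then exposes a constant term. If `v` were in `J`,
all paths ending at `v` would be homogeneous elements of `J`. -/
theorem exists_isReduced (hE : E.RowFinite) (hJ : ¬ E.IsGradedIdeal F J) :
    ∃ v L, IsReduced J v L := by
  unfold IsGradedIdeal at hJ
  push Not at hJ
  obtain ⟨x, hxJ, hx⟩ := hJ
  obtain ⟨n, hn⟩ := exists_mul_realPath_mem_span x 0
  obtain ⟨v, l, hl, hxl⟩ := exists_mul_realPath_notMem hE (J := J) hx n
  have hspan := hn v l hl
  have hJ' : x * realPath E F v l ∈ J := J.mul_mem_right _ _ hxJ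
  generalize x * realPath E F v l = y at hspan hJ' hxl
  have hv : E.lvert F v ∉ J := fun h => hxl (mem_gradedPart_of_lvert_mem h
    (Submodule.span_mono (Set.image_subset_range _ _) hspan))
  obtain ⟨N, hN⟩ : ∃ N : ℕ, y ∈ Submodule.span F (realPath E F v '' {l | l.length < N}) := by
    have hle : ∀ {N M : ℕ}, N ≤ M → Submodule.span F (realPath E F v '' {l | l.length < N}) ≤
        Submodule.span F (realPath E F v '' {l | l.length < M}) := fun {N M} h =>
      Submodule.span_mono (Set.image_mono fun l (hl : l.length < N) => hl.trans_le h)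
    clear hJ' hxl
    induction hspan using Submodule.span_induction with
    | zero => exact ⟨0, zero_mem _⟩
    | add a b _ _ ha hb =>
      obtain ⟨N, hN⟩ := ha
      obtain ⟨M, hM⟩ := hb
      exact ⟨max N M, add_mem (hle (le_max_left _ _) hN) (hle (le_max_right _ _) hM)⟩
    | smul c a _ ha =>
      obtain ⟨N, hN⟩ := ha
      exact ⟨N, Submodule.smul_mem _ c hN⟩
    | mem y hy =>
      obtain ⟨l, _, rfl⟩ := hy
      exact ⟨l.length + 1, Submodule.subset_span ⟨l, Nat.lt_succ_self _, rfl⟩⟩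
  obtain ⟨c, hc, z, hz, hzJ⟩ := exists_smul_lvert_add_mem N hJ' hxl hN
  obtain ⟨L, hL, rfl⟩ := exists_pathComb_eq hz
  exact ⟨v, L, hv, hL, c, hc, hzJ⟩

/-- The vertices in an ideal form a hereditary saturated set. -/
theorem hereditarySaturated_lvert_mem (hE : E.RowFinite) :
    E.HereditarySaturated {v | E.lvert F v ∈ J} where
  rng_mem := by
    intro e he
    change E.lvert F (E.rng e) ∈ J
    rw [← lghost_mul_ledge_self, ← lghost_mul_lvert_src]
    exact J.mul_mem_right _ _ (J.mul_mem_left _ _ he)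
  src_mem := by
    intro v hne h
    change E.lvert F v ∈ J
    rw [lvert_eq_sum v (hE v) hne]
    refine sum_mem fun e he => ?_
    have h1 : E.lvert F (E.rng e) ∈ J := h e (by simpa [outEdges] using he)
    rw [← ledge_mul_lvert_rng]
    exact J.mul_mem_right _ _ (J.mul_mem_left _ _ h1)

variable {J}

theorem lvert_mem_of_smul_mem {v : V} {c : F} (hc : c ≠ 0) (h : c • E.lvert F v ∈ J) :
    E.lvert F v ∈ J := by
  have := J.mul_mem_left (c⁻¹ • E.lvert F v) _ h
  rwa [smul_mul_smul_comm, inv_mul_cancel₀ hc, one_smul, lvert_mul_self] at this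

theorem IsReduced.ne_empty {v : V} {L : List (F × List A)} (h : IsReduced J v L) : L ≠ [] := by
  rintro rfl
  obtain ⟨c, hc, hJ⟩ := h.exists_mem
  refine h.notMem (lvert_mem_of_smul_mem hc ?_)
  simpa [pathComb] using hJ

/-- At a sink `v`, left multiplication by `v` would kill every path of positive length and leave a
nonzero multiple of `v` in `J`. So `v` emits edges, and saturation provides one ending outside. -/
theorem IsReduced.exists_edge (hE : E.RowFinite) {v : V} {L : List (F × List A)}
    (h : IsReduced J v L) : ∃ e, E.src e = v ∧ E.lvert F (E.rng e) ∉ J := by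
  refine exists_edge_notMem (hereditarySaturated_lvert_mem J hE) h.notMem ?_
  by_contra hv
  obtain ⟨c, hc, hJ⟩ := h.exists_mem
  have h0 : ∀ L : List (F × List A), (∀ c ∈ L, c.2 ≠ []) → E.lvert F v * pathComb E v L = 0 := by
    intro L hL
    induction L with
    | nil => simp [pathComb]
    | cons c L ih =>
      obtain ⟨f, l, hfl⟩ := List.exists_cons_of_ne_nil (hL c (by simp))
      rw [pathComb_cons, mul_add, ih fun d hd => hL d (by simp [hd]), add_zero, mul_smul_comm, hfl,
        realPath, ← mul_assoc, lvert_mul_ledge_of_ne fun h => hv ⟨f, h.symm⟩, zero_mul, smul_zero]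
  have h1 := J.mul_mem_left (E.lvert F v) _ hJ
  rw [mul_add, h0 L h.ne_nil, add_zero, mul_smul_comm, lvert_mul_self] at h1
  exact h.notMem (lvert_mem_of_smul_mem hc h1)

open Classical in
theorem lghost_mul_pathComb_mul_ledge (e : A) (L : List (F × List A)) (hL : ∀ c ∈ L, c.2 ≠ []) :
    E.lghost F e * pathComb E (E.src e) L * E.ledge F e = pathComb E (E.rng e)
      ((L.filter fun c => E.lghost F e * realPath E F (E.src e) c.2 * E.ledge F e ≠ 0).map
        fun c => (c.1, c.2.rotate 1)) := by
  induction L with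
  | nil => simp [pathComb]
  | cons c L ih =>
    rw [pathComb_cons, mul_add, add_mul, ih fun d hd => hL d (by simp [hd]), mul_smul_comm,
      smul_mul_assoc]
    by_cases h : E.lghost F e * realPath E F (E.src e) c.2 * E.ledge F e = 0
    · rw [h, smul_zero, zero_add, List.filter_cons_of_neg (by simpa using h)]
    · rw [List.filter_cons_of_pos (by simpa using h), List.map_cons, pathComb_cons,
        ((lghost_mul_realPath_mul_ledge e (hL c (by simp))).resolve_left h).2]

/-- Multiplying by `e*` on the left and `e` on the right gives again a reduced element, now at the
range of `e`. By minimality no term is lost, and only paths beginning with `e` survive. -/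
theorem IsReduced.step {n : ℕ} (hmin : ∀ v L, IsReduced J v L → n ≤ L.length) {e : A}
    {L : List (F × List A)} (h : IsReduced J (E.src e) L) (hn : L.length = n)
    (he : E.lvert F (E.rng e) ∉ J) :
    (∀ c ∈ L, ∃ l, c.2 = e :: l) ∧
      IsReduced J (E.rng e) (L.map fun c => (c.1, c.2.rotate 1)) := by
  classical
  have hred : IsReduced J (E.rng e)
      ((L.filter fun c => E.lghost F e * realPath E F (E.src e) c.2 * E.ledge F e ≠ 0).map
        fun c => (c.1, c.2.rotate 1)) := by
    refine ⟨he, fun c hc => ?_, ?_⟩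
    · obtain ⟨c', hc', rfl⟩ := List.mem_map.1 hc
      simpa using h.ne_nil c' (List.mem_of_mem_filter hc')
    · obtain ⟨c, hc, hJ⟩ := h.exists_mem
      refine ⟨c, hc, ?_⟩
      rw [← lghost_mul_pathComb_mul_ledge e L h.ne_nil]
      have := J.mul_mem_right _ (E.ledge F e) (J.mul_mem_left (E.lghost F e) _ hJ)
      rwa [mul_add, add_mul, mul_smul_comm, smul_mul_assoc, lghost_mul_lvert_src,
        lghost_mul_ledge_self] at this
  have hlen := hmin _ _ hred
  rw [List.length_map, ← hn] at hlen
  have hall := List.length_filter_eq_length_iff.1 (le_antisymm (List.length_filter_le _ _) hlen)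
  rw [List.filter_eq_self.2 hall] at hred
  exact ⟨fun c hc => ((lghost_mul_realPath_mul_ledge e (h.ne_nil c hc)).resolve_left
    (of_decide_eq_true (hall c hc))).1, hred⟩

theorem hasRelativelyExitlessCycle_of_not_isGradedIdeal (hE : E.RowFinite)
    (J : TwoSidedIdeal (E.LeavittPathAlgebra F)) (hJ : ¬ E.IsGradedIdeal F J) :
    E.HasRelativelyExitlessCycle := by
  classical
  have hex : ∃ n v L, IsReduced J v L ∧ L.length = n := by
    obtain ⟨v, L, h⟩ := exists_isReduced J hE hJ
    exact ⟨_, v, L, h, rfl⟩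
  obtain ⟨v, L, hL, hn⟩ := Nat.find_spec hex
  have hmin : ∀ v L, IsReduced J v L → Nat.find hex ≤ L.length := fun v L h =>
    Nat.find_min' hex ⟨v, L, h, rfl⟩
  obtain ⟨c₀, hc₀⟩ := List.exists_mem_of_ne_nil L hL.ne_empty
  let M : ℕ → List (F × List A) := fun i => L.map fun c => (c.1, c.2.rotate i)
  have hMlen : ∀ i, (M i).length = Nat.find hex := fun i => by rw [← hn]; simp [M]
  have hne : ∀ i, c₀.2.rotate i ≠ [] := fun i => by simpa using hL.ne_nil c₀ hc₀
  -- Any term `c₀` traces the cycle: after `i` rotations its first letter is the only edge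
  -- available, and a full turn of the list closes the cycle.
  let e : ℕ → A := fun i => (c₀.2.rotate i).head (hne i)
  have hMmem : ∀ i, (c₀.1, c₀.2.rotate i) ∈ M i := fun i => List.mem_map.2 ⟨c₀, hc₀, rfl⟩
  have hMsucc : ∀ i, (M i).map (fun c => (c.1, c.2.rotate 1)) = M (i + 1) := fun i => by
    simp [M, Function.comp_def, List.rotate_rotate]
  have huniq : ∀ i v, IsReduced J v (M i) → ∀ f, E.src f = v → E.lvert F (E.rng f) ∉ J →
      f = e i := by
    rintro i _ h f rfl hf
    obtain ⟨l, hl⟩ := (h.step hmin (hMlen i) hf).1 _ (hMmem i)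
    have hhead : ∀ l' (h : l' ≠ []), l' = f :: l → f = l'.head h := by
      rintro _ _ rfl
      rfl
    exact hhead _ (hne i) hl
  have hsrc : ∀ i v, IsReduced J v (M i) → E.src (e i) = v ∧ E.lvert F (E.rng (e i)) ∉ J := by
    intro i v h
    obtain ⟨f, hf, hfr⟩ := h.exists_edge hE
    rw [← huniq i v h f hf hfr]
    exact ⟨hf, hfr⟩
  have hnext : ∀ i, IsReduced J (E.src (e i)) (M i) → IsReduced J (E.rng (e i)) (M (i + 1)) :=
    fun i h => hMsucc i ▸ (h.step hmin (hMlen i) (hsrc i _ h).2).2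
  have hred : ∀ i, IsReduced J (E.src (e i)) (M i) := by
    intro i
    induction i with
    | zero =>
      have h0 : IsReduced J v (M 0) := by simpa [M] using hL
      rwa [(hsrc 0 v h0).1]
    | succ i ih => rw [(hsrc (i + 1) _ (hnext i ih)).1]; exact hnext i ih
  refine ⟨_, hereditarySaturated_lvert_mem J hE, e, c₀.2.length,
    List.length_pos_iff.2 (hL.ne_nil c₀ hc₀), fun i => ((hsrc (i + 1) _ (hnext i (hred i))).1).symm,
    fun i => (hred i).notMem,
    fun i f hf hr => huniq i _ (hred i) f hf hr, ?_⟩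
  simp [e]

end reduction

end DirGraph

theorem proposition4p2 {V : Type u} {A : Type w} (E : DirGraph V A) (hE : E.RowFinite)
    (F : Type x) [Field F] :
    (∃ J : TwoSidedIdeal (E.LeavittPathAlgebra F), ¬ E.IsGradedIdeal F J) ↔
      ∃ (I : OrderIdeal (Multiplicative ℤ) E.TalentedMonoid) (a : I.Quotient),
        IsPeriodicElement (Multiplicative ℤ) a := by
  constructor
  · rintro ⟨J, hJ⟩
    exact DirGraph.exists_isPeriodicElement hE
      (DirGraph.hasRelativelyExitlessCycle_of_not_isGradedIdeal hE J hJ)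
  · rintro ⟨I, a, ha⟩
    exact DirGraph.exists_not_isGradedIdeal
      (DirGraph.hasRelativelyExitlessCycle_of_isPeriodicElement hE I a ha) F
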